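/- For $p\in\mathbb{N}$ let $\mathbb{S}^p$ be the set of real symmetric $p\times p$ matrices, and let $\|M\|_*$ denote the nuclear norm of a matrix $M$ (the sum of its singular values). There exist universal constants $C>0$ and $\delta>0$ such that the following holds for all nonnegative integers $n,p,r$ with $n\ge C\,r\,p$. Let $\beta^{(1)},\dots,\beta^{(n)}$ be random vectors in $\mathbb{R}^p$ all of whose entries are independent standard normal random variables, and let $\mathcal{X}:\mathbb{S}^p\to\mathbb{R}^n$ be the symmetric rank-one projection map $$[\mathcal{X}(A)]_i=(\beta^{(i)})^{\mathsf T}A\,\beta^{(i)},\qquad i=1,\dots,n.$$ Then, with probability at least $1-e^{-n\delta}$, nuclear norm minimization recovers exactly all symmetric matrices of rank at most $r$ simultaneously: for every $A\in\mathbb{S}^p$ with $\operatorname{rank}(A)\le r$, the problem $$\min\bigl\{\|M\|_*: M\in\mathbb{S}^p,\ \mathcal{X}(M)=\mathcal{X}(A)\bigr\}$$ has $A$ as its unique solution. (That is, there is a measurable event of probability at least $1-e^{-n\delta}$ on which this holds for all such $A$.) -/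

import Mathlib

/-- The nuclear norm of a real matrix: the sum of its singular values, i.e. of the singular values
of the linear map `x ↦ A x` between Euclidean spaces. (That map has at most `q` nonzero singular
values, those with index `0, …, q - 1`.) -/
noncomputable def nuclearNorm {m q : ℕ} (A : Matrix (Fin m) (Fin q) ℝ) : ℝ :=
  ∑ i : Fin q, (Matrix.toEuclideanLin A).singularValues i

/-- The linear map `A ↦ (bᵢᵀ A bᵢ)ᵢ` of symmetric rank-one projections with projection vectors
`b₁, …, bₙ ∈ ℝᵖ`. -/
def sropMap {n p : ℕ} (b : Fin n → Fin p → ℝ) : Matrix (Fin p) (Fin p) ℝ →ₗ[ℝ] (Fin n → ℝ) where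
  toFun A i := b i ⬝ᵥ (A.mulVec (b i))
  map_add' A B := by
    ext i
    simp [Matrix.add_mulVec, dotProduct_add]
  map_smul' c A := by
    ext i
    simp [Matrix.smul_mulVec, dotProduct_smul]

/-- The random vectors `β⁽¹⁾, …, β⁽ⁿ⁾` in `ℝᵖ` have independent entries (jointly in both the
vector and the coordinate), each with the distribution `𝒟`. -/
def HasIIDEntries {Ω : Type*} [MeasurableSpace Ω] (P : MeasureTheory.Measure Ω) {n p : ℕ}
    (β : Fin n → Fin p → Ω → ℝ) (𝒟 : MeasureTheory.Measure ℝ) : Prop :=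
  ProbabilityTheory.iIndepFun (fun (ij : Fin n × Fin p) => β ij.1 ij.2) P ∧
    ∀ i j, ProbabilityTheory.HasLaw (β i j) 𝒟 P

/-- The set of solutions of the nuclear norm minimization
`argmin {‖M‖_* : M symmetric, X(M) = y}`. -/
def symNuclearNormMinimizers {n p : ℕ} (X : Matrix (Fin p) (Fin p) ℝ →ₗ[ℝ] (Fin n → ℝ))
    (y : Fin n → ℝ) : Set (Matrix (Fin p) (Fin p) ℝ) :=
  {M | (M.IsSymm ∧ X M = y) ∧
    ∀ N : Matrix (Fin p) (Fin p) ℝ, N.IsSymm → X N = y → nuclearNorm M ≤ nuclearNorm N}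

/-- Nuclear norm minimization over symmetric matrices recovers exactly all symmetric matrices of
rank at most `r` from their images under `X`: for each such `A` the minimization problem with
data `y = X(A)` has `A` as its one and only solution. -/
def RecoversSymmetric {n p : ℕ} (X : Matrix (Fin p) (Fin p) ℝ →ₗ[ℝ] (Fin n → ℝ)) (r : ℕ) : Prop :=
  ∀ A : Matrix (Fin p) (Fin p) ℝ, A.IsSymm → A.rank ≤ r → symNuclearNormMinimizers X (X A) = {A}

/-! Group the measurements in pairs. For symmetric `H`, `yᵀHy - xᵀHx` is twice the bilinear form of
`H` at the pair `(x, y)` rotated by `π/4`, and the rotation preserves the law of two independent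
standard Gaussian vectors. So a symmetric `H` in the kernel of the measurement map is annihilated by
`m = n / 2` independent Gaussian bilinear forms (`columnsForm_rotation_eq`, `hasLaw_rotatedPair`).

Let `N` be the sum of the absolute values of these forms. For one fixed matrix, the exponential
Markov inequality puts `N` between constant multiples of `m` times the Frobenius norm, up to an
event of probability exponentially small in `m`. A matrix of rank at most `K` is a product of a `p ×
K` and a `K × p` matrix, so nets in these two factors make the bounds uniform once `m` is a large
multiple of `pK` (`exists_event_sumAbsForm_bounds`). It suffices to take `K` a multiple of `r`.

The rest is deterministic. Let `A` be symmetric of rank at most `r` and `H ≠ 0` symmetric in the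
kernel. In a basis diagonalizing both `A` and the compression of `H` to `ker A`, pinching shows that
adding `H` raises the nuclear norm as soon as the diagonal of `H` has larger `ℓ¹` norm on `ker A`
than on its complement (`nuclearNorm_lt_nuclearNorm_add`). Otherwise, delete from `H` all but the
`s` largest diagonal entries of the compression. What remains has rank at most `2r + s`, yet its `N`
is too small for its Frobenius norm, because the deleted part is controlled by blocks of decreasing
entries (`sum_abs_inner_lt_of_seminorm_eq_zero`). -/

open Module

/-! ### The nuclear norm in orthonormal bases -/

/-- The pinching bound: the diagonal of a matrix in any orthonormal basis has `ℓ¹` norm at most the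
nuclear norm. -/
theorem sum_abs_inner_le_nuclearNorm {p : ℕ} {ι : Type*} [Fintype ι]
    (M : Matrix (Fin p) (Fin p) ℝ) (e : OrthonormalBasis ι ℝ (EuclideanSpace ℝ (Fin p))) :
    ∑ i, |inner ℝ (e i) (Matrix.toEuclideanLin M (e i))| ≤ nuclearNorm M := by
  set T := Matrix.toEuclideanLin M with hT
  have hn : finrank ℝ (EuclideanSpace ℝ (Fin p)) = p := by simp
  set v := T.isSymmetric_adjoint_comp_self.eigenvectorBasis hn with hv
  have hTv : ∀ j, ‖T (v j)‖ = T.singularValues j := by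
    intro j
    have h1 : ‖T (v j)‖ ^ 2 = T.singularValues j ^ 2 := by
      rw [T.sq_singularValues_fin hn j, ← real_inner_self_eq_norm_sq,
        ← LinearMap.adjoint_inner_right]
      have := T.isSymmetric_adjoint_comp_self.apply_eigenvectorBasis hn j
      rw [LinearMap.comp_apply] at this
      rw [this]
      simp [inner_smul_right, ← hv]
    exact (sq_eq_sq₀ (norm_nonneg _) (T.singularValues_nonneg j)).1 h1
  have key : ∀ i, |inner ℝ (e i) (T (e i))| ≤
      ∑ j, |inner ℝ (v j) (e i)| * |inner ℝ (e i) (T (v j))| := by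
    intro i
    have : T (e i) = ∑ j, inner ℝ (v j) (e i) • T (v j) := by
      conv_lhs => rw [← v.sum_repr' (e i)]
      simp
    rw [this, inner_sum]
    refine (Finset.abs_sum_le_sum_abs _ _).trans (le_of_eq ?_)
    simp [inner_smul_right, abs_mul]
  calc ∑ i, |inner ℝ (e i) (T (e i))|
      ≤ ∑ i, ∑ j, |inner ℝ (v j) (e i)| * |inner ℝ (e i) (T (v j))| :=
        Finset.sum_le_sum fun i _ => key i
    _ = ∑ j, ∑ i, |inner ℝ (v j) (e i)| * |inner ℝ (e i) (T (v j))| := Finset.sum_comm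
    _ ≤ ∑ j : Fin p, T.singularValues j := by
        refine Finset.sum_le_sum fun j _ => ?_
        refine (Real.sum_mul_le_sqrt_mul_sqrt _ _ _).trans (le_of_eq ?_)
        have h1 : ∑ i, |inner ℝ (v j) (e i)| ^ 2 = 1 := by
          have := e.sum_sq_norm_inner_left (v j)
          simpa using this
        have h2 : ∑ i, |inner ℝ (e i) (T (v j))| ^ 2 = ‖T (v j)‖ ^ 2 := by
          have := e.sum_sq_norm_inner_right (T (v j))
          simpa using this
        rw [h1, h2, Real.sqrt_one, one_mul, Real.sqrt_sq (norm_nonneg _), hTv]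
    _ = nuclearNorm M := rfl

/-- Evaluating `⟪e i, T² (v j)⟫` on either side shows that `|α i|` equals the `j`-th singular value
unless `e i ⊥ v j`. The weights `⟪e i, v j⟫²` are doubly stochastic, so the two sums agree. -/
theorem nuclearNorm_eq_sum_abs_of_eigenbasis {p : ℕ} {ι : Type*} [Fintype ι]
    (M : Matrix (Fin p) (Fin p) ℝ) (hM : M.IsSymm)
    (e : OrthonormalBasis ι ℝ (EuclideanSpace ℝ (Fin p))) (α : ι → ℝ)
    (hα : ∀ i, Matrix.toEuclideanLin M (e i) = α i • e i) :
    nuclearNorm M = ∑ i, |α i| := by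
  set T := Matrix.toEuclideanLin M with hT
  have hTs : LinearMap.adjoint T = T := by
    rw [hT, ← Matrix.toEuclideanLin_conjTranspose_eq_adjoint, Matrix.conjTranspose_eq_transpose_of_trivial, hM]
  have hn : finrank ℝ (EuclideanSpace ℝ (Fin p)) = p := by simp
  set v := T.isSymmetric_adjoint_comp_self.eigenvectorBasis hn with hv
  have hTT : ∀ j, T (T (v j)) = (T.singularValues j) ^ 2 • v j := by
    intro j
    have := T.isSymmetric_adjoint_comp_self.apply_eigenvectorBasis hn j
    rw [LinearMap.comp_apply, ← hv] at this
    rw [T.sq_singularValues_fin hn j]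
    exact (LinearMap.congr_fun hTs _).symm.trans this
  have hsym : ∀ x y, inner ℝ (T x) y = inner ℝ x (T y) := by
    intro x y
    rw [← LinearMap.adjoint_inner_right, hTs]
  have key : ∀ i j, |α i| * inner ℝ (e i) (v j) ^ 2 =
      T.singularValues j * inner ℝ (e i) (v j) ^ 2 := by
    intro i j
    by_cases h0 : inner ℝ (e i) (v j) = 0
    · simp [h0]
    · have h1 : inner ℝ (e i) (T (T (v j))) = α i ^ 2 * inner ℝ (e i) (v j) := by
        rw [← hsym, hα, inner_smul_left, ← hsym, hα, inner_smul_left]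
        simp; ring
      rw [hTT, inner_smul_right] at h1
      have h2 := mul_right_cancel₀ h0 h1
      rw [(sq_eq_sq₀ (abs_nonneg _) (T.singularValues_nonneg j)).1 (by rw [sq_abs, h2])]
  have h1 : ∑ i, |α i| = ∑ i, ∑ j, |α i| * inner ℝ (e i) (v j) ^ 2 := by
    refine Finset.sum_congr rfl fun i _ => ?_
    rw [← Finset.mul_sum]
    have := v.sum_sq_norm_inner_left (e i)
    simp at this
    simp [this]
  have h2 : nuclearNorm M = ∑ j : Fin p, ∑ i, T.singularValues j * inner ℝ (e i) (v j) ^ 2 := by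
    refine Finset.sum_congr rfl fun j _ => ?_
    rw [← Finset.mul_sum]
    have := e.sum_sq_norm_inner_right (v j)
    simp at this
    simp [this, hT]
  rw [h1, h2, Finset.sum_comm]
  exact Finset.sum_congr rfl fun _ _ => Finset.sum_congr rfl fun _ _ => (key _ _).symm

/-- A symmetric operator `A` has an orthonormal eigenbasis in which, moreover, the compression of a
second symmetric operator `H` to the kernel of `A` is diagonal. -/
theorem exists_eigenbasis_diagonalizing_compression {E : Type*} [NormedAddCommGroup E]
    [InnerProductSpace ℝ E] [FiniteDimensional ℝ E] (A H : E →ₗ[ℝ] E)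
    (hA : A.IsSymmetric) (hH : H.IsSymmetric) :
    ∃ (a b : ℕ) (e : OrthonormalBasis (Fin a ⊕ Fin b) ℝ E) (α : Fin a ⊕ Fin b → ℝ),
      a = finrank ℝ A.range ∧ (∀ i, A (e i) = α i • e i) ∧ (∀ i, α (Sum.inr i) = 0) ∧
      ∀ i j, i ≠ j → inner ℝ (e (Sum.inr i)) (H (e (Sum.inr j))) = 0 := by
  set K := A.ker with hK
  have hmap : ∀ x ∈ Kᗮ, A x ∈ Kᗮ := by
    intro x _
    rw [Submodule.mem_orthogonal]
    intro u hu
    rw [← hA, LinearMap.mem_ker.1 hu, inner_zero_left]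
  have hAs : (A.restrict hmap).IsSymmetric := hA.restrict_invariant hmap
  set P : E →ₗ[ℝ] K := (K.orthogonalProjectionOnto : E →L[ℝ] K).toLinearMap with hP
  set G : K →ₗ[ℝ] K := P ∘ₗ H ∘ₗ K.subtype with hG
  have hGinner : ∀ x y : K, inner ℝ x (G y) = inner ℝ (x : E) (H y) := by
    intro x y
    simp [hG, hP]
  have hGs : G.IsSymmetric := by
    intro x y
    rw [hGinner, real_inner_comm, hGinner, ← hH, real_inner_comm]
  set a := finrank ℝ Kᗮ with ha
  set b := finrank ℝ K with hb
  -- The basis joins an eigenbasis of `A` on `Kᗮ` to an eigenbasis on `K = ker A` of the compression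
  -- `G` of `H`.
  set u := hAs.eigenvectorBasis (n := a) rfl
  set w := hGs.eigenvectorBasis (n := b) rfl
  have hsum : b + a = finrank ℝ E := K.finrank_add_finrank_orthogonal
  have hrn := A.finrank_range_add_finrank_ker
  let f : Fin a ⊕ Fin b → E := Sum.elim (fun i => (u i : E)) (fun i => (w i : E))
  have hf : Orthonormal ℝ f := by
    constructor
    · rintro (i | i)
      · exact u.orthonormal.1 i
      · exact w.orthonormal.1 i
    · rintro (i | i) (j | j) hij
      · exact u.orthonormal.2 (fun h => hij (by rw [h]))
      · exact Submodule.inner_left_of_mem_orthogonal (w j).2 (u i).2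
      · exact Submodule.inner_right_of_mem_orthogonal (w i).2 (u j).2
      · exact w.orthonormal.2 (fun h => hij (by rw [h]))
  obtain ⟨e, he⟩ := Orthonormal.exists_orthonormalBasis_extension_of_card_eq
    (𝕜 := ℝ) (E := E) (ι := Fin a ⊕ Fin b) (by simp; omega) (v := f) (s := Set.univ)
    (hf.comp _ Subtype.val_injective)
  have he' : ∀ i, e i = f i := fun i => he i trivial
  refine ⟨a, b, e, Sum.elim (fun i => hAs.eigenvalues rfl i) 0, by
      rw [← hK, ← hb] at hrn; omega, ?_, by simp, ?_⟩
  · rintro (i | i)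
    · rw [he']
      exact congrArg Subtype.val (hAs.apply_eigenvectorBasis (n := a) rfl i)
    · rw [he']
      simp [f, LinearMap.mem_ker.1 (w i).2]
  · intro i j hij
    rw [he', he']
    have : inner ℝ (w i : E) (H (w j)) = 0 := by
      rw [← hGinner, hGs.apply_eigenvectorBasis, inner_smul_right, w.orthonormal.2 hij, mul_zero]
    exact this

/-- By pinching, the diagonal of `A + H` in the basis `e` bounds its nuclear norm from below. On the
`inl` block `H` cancels at most the sum of its own absolute entries; on the `inr` block `A` vanishes
and `H` counts in full. -/
theorem nuclearNorm_lt_nuclearNorm_add {p a b : ℕ} (A H : Matrix (Fin p) (Fin p) ℝ)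
    (hA : A.IsSymm) (e : OrthonormalBasis (Fin a ⊕ Fin b) ℝ (EuclideanSpace ℝ (Fin p)))
    (α : Fin a ⊕ Fin b → ℝ) (hα : ∀ i, Matrix.toEuclideanLin A (e i) = α i • e i)
    (hα0 : ∀ i, α (Sum.inr i) = 0)
    (hlt : ∑ i, |inner ℝ (e (Sum.inl i)) (Matrix.toEuclideanLin H (e (Sum.inl i)))| <
      ∑ i, |inner ℝ (e (Sum.inr i)) (Matrix.toEuclideanLin H (e (Sum.inr i)))|) :
    nuclearNorm A < nuclearNorm (A + H) := by
  refine lt_of_lt_of_le ?_ (sum_abs_inner_le_nuclearNorm (A + H) e)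
  rw [nuclearNorm_eq_sum_abs_of_eigenbasis A hA e α hα]
  have hin : ∀ i, inner ℝ (e i) (Matrix.toEuclideanLin (A + H) (e i)) =
      α i + inner ℝ (e i) (Matrix.toEuclideanLin H (e i)) := by
    intro i
    rw [map_add, LinearMap.add_apply, hα, inner_add_right, inner_smul_right]
    simp
  simp only [hin, Fintype.sum_sum_type, hα0, abs_zero, Finset.sum_const_zero, zero_add, add_zero]
  have : ∑ i, |α (Sum.inl i)| ≤
      ∑ i, |α (Sum.inl i) + inner ℝ (e (Sum.inl i)) (Matrix.toEuclideanLin H (e (Sum.inl i)))| +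
      ∑ i, |inner ℝ (e (Sum.inl i)) (Matrix.toEuclideanLin H (e (Sum.inl i)))| := by
    rw [← Finset.sum_add_distrib]
    refine Finset.sum_le_sum fun i _ => ?_
    have := abs_sub (α (Sum.inl i) + inner ℝ (e (Sum.inl i)) (Matrix.toEuclideanLin H (e (Sum.inl i))))
      (inner ℝ (e (Sum.inl i)) (Matrix.toEuclideanLin H (e (Sum.inl i))))
    simpa using this
  linarith

/-! ### The Frobenius norm and factorization of low-rank operators -/

/-- The columns of an endomorphism of Euclidean space; the `ℓ²` norm of this tuple is the Frobenius
norm of the endomorphism. -/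
noncomputable def columns {p : ℕ} :
    (EuclideanSpace ℝ (Fin p) →ₗ[ℝ] EuclideanSpace ℝ (Fin p)) →ₗ[ℝ]
      PiLp 2 (fun _ : Fin p => EuclideanSpace ℝ (Fin p)) where
  toFun T := WithLp.toLp 2 fun j => T (EuclideanSpace.single j 1)
  map_add' S T := by ext; simp
  map_smul' c T := by ext; simp

theorem columns_apply {p : ℕ} (T : EuclideanSpace ℝ (Fin p) →ₗ[ℝ] EuclideanSpace ℝ (Fin p))
    (j : Fin p) : columns T j = T (EuclideanSpace.single j 1) := rfl

theorem sum_norm_sq_eq_sum_norm_adjoint_sq {E ι κ : Type*} [NormedAddCommGroup E]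
    [InnerProductSpace ℝ E] [FiniteDimensional ℝ E] [Fintype ι] [Fintype κ] (T : E →ₗ[ℝ] E)
    (e : OrthonormalBasis ι ℝ E) (f : OrthonormalBasis κ ℝ E) :
    ∑ i, ‖T (f i)‖ ^ 2 = ∑ k, ‖LinearMap.adjoint T (e k)‖ ^ 2 := by
  have h1 : ∀ i, ‖T (f i)‖ ^ 2 = ∑ k, ‖inner ℝ (e k) (T (f i))‖ ^ 2 := fun i =>
    (e.sum_sq_norm_inner_right _).symm
  have h2 : ∀ k, ‖LinearMap.adjoint T (e k)‖ ^ 2 = ∑ i, ‖inner ℝ (e k) (T (f i))‖ ^ 2 := by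
    intro k
    rw [← f.sum_sq_norm_inner_left]
    simp [LinearMap.adjoint_inner_left]
  simp only [h1, h2]
  exact Finset.sum_comm

theorem norm_columns_sq {p : ℕ} {ι : Type*} [Fintype ι]
    (T : EuclideanSpace ℝ (Fin p) →ₗ[ℝ] EuclideanSpace ℝ (Fin p))
    (e : OrthonormalBasis ι ℝ (EuclideanSpace ℝ (Fin p))) :
    ‖columns T‖ ^ 2 = ∑ i, ‖T (e i)‖ ^ 2 := by
  rw [PiLp.norm_sq_eq_of_L2, sum_norm_sq_eq_sum_norm_adjoint_sq T e e,
    ← sum_norm_sq_eq_sum_norm_adjoint_sq T e (EuclideanSpace.basisFun (Fin p) ℝ)]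
  simp [columns_apply]

theorem columns_eq_zero_iff {p : ℕ}
    {T : EuclideanSpace ℝ (Fin p) →ₗ[ℝ] EuclideanSpace ℝ (Fin p)} : columns T = 0 ↔ T = 0 := by
  refine ⟨fun h => ?_, fun h => by rw [h, map_zero]⟩
  refine (EuclideanSpace.basisFun (Fin p) ℝ).toBasis.ext fun j => ?_
  have := congrArg (fun v => v j) h
  simpa [columns_apply] using this

/-- An endomorphism whose range has dimension at most `K` factors through `ℝᴷ` as a contraction
after a map with the same Frobenius norm. -/
theorem exists_factorization_of_range_le {p K : ℕ}
    (T : EuclideanSpace ℝ (Fin p) →ₗ[ℝ] EuclideanSpace ℝ (Fin p))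
    (W : Submodule ℝ (EuclideanSpace ℝ (Fin p))) (hTW : ∀ x, T x ∈ W) (hW : finrank ℝ W ≤ K) :
    ∃ (Q : EuclideanSpace ℝ (Fin K) →L[ℝ] EuclideanSpace ℝ (Fin p))
      (R : PiLp 2 (fun _ : Fin p => EuclideanSpace ℝ (Fin K))),
      ‖Q‖ ≤ 1 ∧ ‖R‖ = ‖columns T‖ ∧ ∀ j, columns T j = Q (R j) := by
  set w := stdOrthonormalBasis ℝ W
  have hortho : Orthonormal ℝ (fun i => EuclideanSpace.basisFun (Fin K) ℝ (Fin.castLE hW i)) :=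
    (EuclideanSpace.basisFun (Fin K) ℝ).orthonormal.comp _ (Fin.castLE_injective hW)
  -- `J` embeds `W` isometrically in `ℝᴷ`. Its adjoint is a left inverse and a contraction, hence
  -- serves as `Q`; `R` consists of the embedded columns.
  let J : W →ₗᵢ[ℝ] EuclideanSpace ℝ (Fin K) :=
    (w.toBasis.constr ℝ fun i => EuclideanSpace.basisFun (Fin K) ℝ (Fin.castLE hW i)).isometryOfOrthonormal
      (v := w.toBasis) (by simp) (by
        convert! hortho using 1
        ext1 i
        exact w.toBasis.constr_basis ℝ _ i)
  set JL := J.toContinuousLinearMap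
  have hJ : ∀ x, ContinuousLinearMap.adjoint JL (JL x) = x := by
    intro x
    refine ext_inner_left ℝ fun y => ?_
    rw [ContinuousLinearMap.adjoint_inner_right]
    exact J.inner_map_map y x
  have hJn : ‖ContinuousLinearMap.adjoint JL‖ ≤ 1 := by
    rw [LinearIsometryEquiv.norm_map]
    exact J.norm_toContinuousLinearMap_le
  refine ⟨W.subtypeL.comp (ContinuousLinearMap.adjoint JL),
    WithLp.toLp 2 fun j => JL ⟨T (EuclideanSpace.single j 1), hTW _⟩, ?_, ?_, ?_⟩
  · refine (ContinuousLinearMap.opNorm_comp_le _ _).trans ?_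
    exact mul_le_one₀ W.norm_subtypeL_le (ContinuousLinearMap.opNorm_nonneg _) hJn
  · rw [← sq_eq_sq₀ (norm_nonneg _) (norm_nonneg _), PiLp.norm_sq_eq_of_L2, PiLp.norm_sq_eq_of_L2]
    refine Finset.sum_congr rfl fun j _ => ?_
    congr 1
    exact J.norm_map _
  · intro j
    simp only [ContinuousLinearMap.comp_apply, hJ, columns_apply]
    rfl

/-! ### Blocks of decreasing entries and the null space property -/

theorem Finset.exists_subset_card_eq_forall_le {ι : Type*} [DecidableEq ι] (I : Finset ι)
    (w : ι → ℝ) (s : ℕ) (hs : s ≤ I.card) :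
    ∃ T ⊆ I, T.card = s ∧ ∀ i ∈ T, ∀ j ∈ I \ T, w j ≤ w i := by
  induction s with
  | zero => exact ⟨∅, by simp, by simp, by simp⟩
  | succ s ih =>
    obtain ⟨T, hTI, hT, hle⟩ := ih (by omega)
    have hne : (I \ T).Nonempty := by
      rw [← Finset.card_pos, Finset.card_sdiff_of_subset hTI]; omega
    obtain ⟨x, hx, hmax⟩ := Finset.exists_max_image (I \ T) w hne
    rw [Finset.mem_sdiff] at hx
    refine ⟨insert x T, Finset.insert_subset hx.1 hTI, by rw [Finset.card_insert_of_notMem hx.2, hT],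
      ?_⟩
    intro i hi j hj
    rw [Finset.mem_sdiff, Finset.mem_insert, not_or] at hj
    have hj' : j ∈ I \ T := Finset.mem_sdiff.2 ⟨hj.1, hj.2.2⟩
    rcases Finset.mem_insert.1 hi with rfl | hi
    · exact hmax j hj'
    · exact hle i hi j hj'

theorem Finset.le_sum_div_of_forall_le {ι : Type*} {T : Finset ι} {w : ι → ℝ} {s : ℕ} (hs : 0 < s)
    (hT : T.card = s) {y : ℝ} (hy : ∀ i ∈ T, y ≤ w i) : y ≤ (∑ i ∈ T, w i) / s := by
  rw [le_div_iff₀ (by exact_mod_cast hs), mul_comm]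
  have := Finset.card_nsmul_le_sum T w y hy
  rwa [hT, nsmul_eq_mul] at this

/-- A subadditive set function which is controlled by the `ℓ²` norm of the weights on sets with at
most `s` elements is controlled by the `ℓ¹` norm and the supremum of the weights on all sets. -/
theorem le_of_subadditive_of_le_sqrt_sum_sq {ι : Type*} [DecidableEq ι] (g : Finset ι → ℝ)
    (w : ι → ℝ) {C : ℝ} (hC : 0 ≤ C) {s : ℕ} (hs : 0 < s) (hw : ∀ i, 0 ≤ w i)
    (hadd : ∀ J J', Disjoint J J' → g (J ∪ J') ≤ g J + g J')
    (hsmall : ∀ J, J.card ≤ s → g J ≤ C * √(∑ i ∈ J, w i ^ 2)) (I : Finset ι) :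
    ∀ b, 0 ≤ b → (∀ i ∈ I, w i ≤ b) → g I ≤ C * (√s * b + (∑ i ∈ I, w i) / √s) := by
  have hs0 : (0 : ℝ) < s := by exact_mod_cast hs
  have hblock : ∀ J : Finset ι, J.card ≤ s → ∀ b, 0 ≤ b → (∀ i ∈ J, w i ≤ b) →
      g J ≤ C * (√s * b) := by
    intro J hJ b hb hle
    refine (hsmall J hJ).trans (mul_le_mul_of_nonneg_left ?_ hC)
    rw [Real.sqrt_le_left (by positivity), mul_pow, Real.sq_sqrt hs0.le]
    calc ∑ i ∈ J, w i ^ 2 ≤ ∑ _i ∈ J, b ^ 2 :=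
          Finset.sum_le_sum fun i hi => pow_le_pow_left₀ (hw i) (hle i hi) 2
      _ = J.card * b ^ 2 := by simp
      _ ≤ s * b ^ 2 := by gcongr
  induction I using Finset.strongInduction with
  | H I ih =>
    intro b hb hle
    by_cases hcard : I.card ≤ s
    · refine (hblock I hcard b hb hle).trans (mul_le_mul_of_nonneg_left ?_ hC)
      have : 0 ≤ (∑ i ∈ I, w i) / √s := div_nonneg (Finset.sum_nonneg fun i _ => hw i) (by positivity)
      linarith
    -- Split off the `s` largest weights. Every remaining weight is at most their average, which
    -- becomes the new `b`; the sup term of each later block is thus paid for by the `ℓ¹` norm of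
    -- the block before it.
    · obtain ⟨T, hTI, hT, htop⟩ := I.exists_subset_card_eq_forall_le w s (by omega)
      have hss : I \ T ⊂ I := Finset.sdiff_ssubset hTI (Finset.card_pos.1 (by omega))
      have h1 := hblock T hT.le b hb fun i hi => hle i (hTI hi)
      have h2 := ih (I \ T) hss ((∑ i ∈ T, w i) / s)
        (div_nonneg (Finset.sum_nonneg fun i _ => hw i) hs0.le)
        fun j hj => Finset.le_sum_div_of_forall_le hs hT fun i hi => htop i hi j hj
      have h3 := hadd T (I \ T) Finset.disjoint_sdiff
      rw [Finset.union_sdiff_of_subset hTI] at h3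
      have h4 : √s * ((∑ i ∈ T, w i) / s) = (∑ i ∈ T, w i) / √s := by
        rw [mul_div_left_comm, Real.sqrt_div_self', mul_one_div]
      have h5 : ∑ i ∈ I, w i = ∑ i ∈ T, w i + ∑ i ∈ I \ T, w i := by
        rw [add_comm, Finset.sum_sdiff hTI]
      rw [h4] at h2
      rw [h5, add_div]
      linarith

/-- The operator which is diagonal in the orthonormal basis `e` with diagonal entries `c`. -/
noncomputable def OrthonormalBasis.diag {E ι : Type*} [NormedAddCommGroup E] [InnerProductSpace ℝ E]
    [Fintype ι] (e : OrthonormalBasis ι ℝ E) (c : ι → ℝ) : E →ₗ[ℝ] E :=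
  e.toBasis.constr ℝ fun i => c i • e i

theorem OrthonormalBasis.diag_apply {E ι : Type*} [NormedAddCommGroup E] [InnerProductSpace ℝ E]
    [Fintype ι] (e : OrthonormalBasis ι ℝ E) (c : ι → ℝ) (i : ι) : e.diag c (e i) = c i • e i := by
  have := e.toBasis.constr_basis ℝ (fun i => c i • e i) i
  simpa [OrthonormalBasis.diag] using this

theorem OrthonormalBasis.diag_add {E ι : Type*} [NormedAddCommGroup E] [InnerProductSpace ℝ E]
    [Fintype ι] (e : OrthonormalBasis ι ℝ E) (c d : ι → ℝ) :
    e.diag (c + d) = e.diag c + e.diag d := by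
  refine e.toBasis.ext fun i => ?_
  simp [OrthonormalBasis.diag_apply, add_smul]

theorem norm_columns_diag {p : ℕ} {ι : Type*} [Fintype ι]
    (e : OrthonormalBasis ι ℝ (EuclideanSpace ℝ (Fin p))) (c : ι → ℝ) :
    ‖columns (e.diag c)‖ = √(∑ i, c i ^ 2) := by
  rw [← Real.sqrt_sq (norm_nonneg _), norm_columns_sq _ e]
  simp [OrthonormalBasis.diag_apply, norm_smul]

/-- A linear map whose values on an orthonormal basis lie in the span of a family of vectors takes
all its values there. -/
theorem OrthonormalBasis.apply_mem_of_forall {E ι : Type*} [NormedAddCommGroup E]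
    [InnerProductSpace ℝ E] [Fintype ι] (e : OrthonormalBasis ι ℝ E) (T : E →ₗ[ℝ] E)
    (W : Submodule ℝ E) (h : ∀ i, T (e i) ∈ W) (x : E) : T x ∈ W := by
  rw [← e.sum_repr' x, map_sum]
  exact W.sum_mem fun i _ => by rw [map_smul]; exact W.smul_mem _ (h i)

/-- Seminorm bounds on operators of low rank imply the null space property. -/
theorem sum_abs_inner_lt_of_seminorm_eq_zero {p a b r s : ℕ} {c C : ℝ} (hC : 0 ≤ C)
    (hs : 0 < s) (har : a ≤ r) (hCc : C * √r < c * √s)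
    (N : Seminorm ℝ (PiLp 2 (fun _ : Fin p => EuclideanSpace ℝ (Fin p))))
    (hlow : ∀ (T : EuclideanSpace ℝ (Fin p) →ₗ[ℝ] EuclideanSpace ℝ (Fin p))
      (W : Submodule ℝ (EuclideanSpace ℝ (Fin p))), (∀ x, T x ∈ W) → finrank ℝ W ≤ 2 * r + s →
      c * ‖columns T‖ ≤ N (columns T))
    (hup : ∀ (T : EuclideanSpace ℝ (Fin p) →ₗ[ℝ] EuclideanSpace ℝ (Fin p))
      (W : Submodule ℝ (EuclideanSpace ℝ (Fin p))), (∀ x, T x ∈ W) → finrank ℝ W ≤ s →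
      N (columns T) ≤ C * ‖columns T‖)
    (e : OrthonormalBasis (Fin a ⊕ Fin b) ℝ (EuclideanSpace ℝ (Fin p)))
    (H : EuclideanSpace ℝ (Fin p) →ₗ[ℝ] EuclideanSpace ℝ (Fin p))
    (hdiag : ∀ i j, i ≠ j → inner ℝ (e (Sum.inr i)) (H (e (Sum.inr j))) = 0)
    (hH : N (columns H) = 0) (hH0 : H ≠ 0) :
    ∑ i, |inner ℝ (e (Sum.inl i)) (H (e (Sum.inl i)))| <
      ∑ i, |inner ℝ (e (Sum.inr i)) (H (e (Sum.inr i)))| := by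
  classical
  by_contra! hle
  set h : Fin b → ℝ := fun i => inner ℝ (e (Sum.inr i)) (H (e (Sum.inr i))) with hh
  set k : Fin a → ℝ := fun i => inner ℝ (e (Sum.inl i)) (H (e (Sum.inl i))) with hk
  let D : Finset (Fin b) → EuclideanSpace ℝ (Fin p) →ₗ[ℝ] EuclideanSpace ℝ (Fin p) :=
    fun J => e.diag (Sum.elim 0 fun i => if i ∈ J then h i else 0)
  let g : Finset (Fin b) → ℝ := fun J => N (columns (D J))
  have hs0 : (0 : ℝ) < √s := by positivity
  have hDnorm : ∀ J, ‖columns (D J)‖ = √(∑ i ∈ J, |h i| ^ 2) := by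
    intro J
    simp only [D, norm_columns_diag, Fintype.sum_sum_type]
    simp [ite_pow]
  have hgadd : ∀ J J', Disjoint J J' → g (J ∪ J') ≤ g J + g J' := by
    intro J J' hJ
    have : D (J ∪ J') = D J + D J' := by
      simp only [D]
      rw [← OrthonormalBasis.diag_add]
      congr 1
      ext (i | i)
      · simp
      · have := fun hi : i ∈ J => Finset.disjoint_left.1 hJ hi
        by_cases h1 : i ∈ J <;> by_cases h2 : i ∈ J' <;> simp_all
    simp only [g, this, map_add]
    exact map_add_le_add N _ _
  have hgsmall : ∀ J, J.card ≤ s → g J ≤ C * √(∑ i ∈ J, |h i| ^ 2) := by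
    intro J hJ
    rw [← hDnorm]
    refine hup _ (Submodule.span ℝ (Set.range fun i : J => e (Sum.inr i.1))) ?_ ?_
    · refine e.apply_mem_of_forall _ _ ?_
      rintro (i | i)
      · simp [D, OrthonormalBasis.diag_apply]
      · simp only [D, OrthonormalBasis.diag_apply, Sum.elim_inr]
        split_ifs with hi
        · exact Submodule.smul_mem _ _ (Submodule.subset_span ⟨⟨i, hi⟩, rfl⟩)
        · simp
    · exact (finrank_range_le_card _).trans (by simpa using hJ)
  have hblocks := le_of_subadditive_of_le_sqrt_sum_sq g (fun i => |h i|) hC hs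
    (fun i => abs_nonneg _) hgadd hgsmall
  obtain ⟨T, hTs, hgT⟩ : ∃ T : Finset (Fin b), T.card ≤ s ∧
      g (Finset.univ \ T) ≤ C * ((∑ i, |h i|) / √s) := by
    by_cases hsb : s ≤ b
    · obtain ⟨T, -, hT, htop⟩ := (Finset.univ : Finset (Fin b)).exists_subset_card_eq_forall_le
        (fun i => |h i|) s (by simpa using hsb)
      refine ⟨T, hT.le, (hblocks (Finset.univ \ T) ((∑ i ∈ T, |h i|) / s) (by positivity)
        fun j hj => Finset.le_sum_div_of_forall_le hs hT fun i hi => htop i hi j hj).trans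
        (le_of_eq ?_)⟩
      have h4 : √s * ((∑ i ∈ T, |h i|) / s) = (∑ i ∈ T, |h i|) / √s := by
        rw [mul_div_left_comm, Real.sqrt_div_self', mul_one_div]
      rw [h4, ← add_div, add_comm, Finset.sum_sdiff (Finset.subset_univ T)]
    · refine ⟨Finset.univ, by simp; omega, ?_⟩
      refine (hgsmall _ (by simp)).trans ?_
      simp
      positivity
  -- The range of `B` is spanned by the vectors `H (e (inl l))`, `e (inl l)` and, for `i ∈ T`, `H (e
  -- (inr i))`: for `i ∉ T` the compression being diagonal leaves only `inl` components. Hence rank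
  -- at most `2r + s`.
  set B := H - D (Finset.univ \ T) with hB
  have hNB : N (columns B) ≤ C * ((∑ i, |h i|) / √s) := by
    refine le_trans ?_ hgT
    rw [hB, map_sub]
    refine (map_sub_le_add N _ _).trans ?_
    rw [hH, zero_add]
  have hBinl : ∀ i, B (e (Sum.inl i)) = H (e (Sum.inl i)) := by
    intro i
    simp [hB, D, OrthonormalBasis.diag_apply]
  have hBlow : c * ‖columns B‖ ≤ N (columns B) := by
    refine hlow B (Submodule.span ℝ (Set.range
      (Sum.elim (fun i => H (e (Sum.inl i)))
        (Sum.elim (fun i => e (Sum.inl i)) fun i : T => H (e (Sum.inr i.1)))))) ?_ ?_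
    · refine e.apply_mem_of_forall _ _ ?_
      rintro (i | i)
      · rw [hBinl]
        exact Submodule.subset_span ⟨Sum.inl i, rfl⟩
      · by_cases hi : i ∈ T
        · have : B (e (Sum.inr i)) = H (e (Sum.inr i)) := by
            simp [hB, D, OrthonormalBasis.diag_apply, hi]
          rw [this]
          exact Submodule.subset_span ⟨Sum.inr (Sum.inr ⟨i, hi⟩), rfl⟩
        · have : B (e (Sum.inr i)) =
              ∑ l, inner ℝ (e (Sum.inl l)) (H (e (Sum.inr i))) • e (Sum.inl l) := by
            have h1 := e.sum_repr' (H (e (Sum.inr i)))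
            rw [Fintype.sum_sum_type, Finset.sum_eq_single_of_mem (s := (Finset.univ : Finset (Fin b)))
              i (Finset.mem_univ _) (fun j _ hj => by rw [hdiag j i hj, zero_smul])] at h1
            rw [hB, LinearMap.sub_apply]
            conv_lhs => rw [← h1]
            simp [D, OrthonormalBasis.diag_apply, hi, hh]
          rw [this]
          exact Submodule.sum_mem _ fun l _ =>
            Submodule.smul_mem _ _ (Submodule.subset_span ⟨Sum.inr (Sum.inl l), rfl⟩)
    · refine (finrank_range_le_card _).trans ?_
      simp
      omega
  have hkB : ∑ i, |k i| ≤ √r * ‖columns B‖ := by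
    have h1 := Real.sum_mul_le_sqrt_mul_sqrt Finset.univ (fun _ : Fin a => (1 : ℝ)) (fun i => |k i|)
    simp only [one_mul, one_pow, Finset.sum_const, Finset.card_univ, Fintype.card_fin, nsmul_eq_mul,
      mul_one] at h1
    refine h1.trans (mul_le_mul (Real.sqrt_le_sqrt (by exact_mod_cast har)) ?_ (by positivity)
      (by positivity))
    rw [← Real.sqrt_sq (norm_nonneg (columns B)), norm_columns_sq _ e, Fintype.sum_sum_type]
    refine Real.sqrt_le_sqrt ((Finset.sum_le_sum fun i _ => ?_).trans
      (le_add_of_nonneg_right (Finset.sum_nonneg fun i _ => by positivity)))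
    rw [hBinl]
    refine pow_le_pow_left₀ (abs_nonneg _) ?_ 2
    refine (abs_real_inner_le_norm _ _).trans ?_
    simp
  have hB0 : ‖columns B‖ = 0 := by
    by_contra hne
    have hpos : 0 < ‖columns B‖ := lt_of_le_of_ne (norm_nonneg _) (Ne.symm hne)
    -- The chain is `c‖B‖ ≤ N B ≤ C ∑|h| / √s ≤ C ∑|k| / √s ≤ C √r ‖B‖ / √s`, which `hCc` forbids
    -- for `B ≠ 0`.
    have h1 : c * ‖columns B‖ ≤ C * (√r * ‖columns B‖ / √s) := by
      refine hBlow.trans (hNB.trans (mul_le_mul_of_nonneg_left ?_ hC))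
      exact div_le_div_of_nonneg_right (hle.trans hkB) hs0.le
    rw [mul_div_assoc', le_div_iff₀ hs0] at h1
    nlinarith
  have hBz : B = 0 := columns_eq_zero_iff.1 (norm_eq_zero.1 hB0)
  have hsum0 : ∑ i, |h i| ≤ 0 := hle.trans (by simpa [hB0] using hkB)
  have hh0 : ∀ i, h i = 0 := by
    intro i
    have := (Finset.sum_eq_zero_iff_of_nonneg (fun i _ => abs_nonneg (h i))).1
      (le_antisymm hsum0 (Finset.sum_nonneg fun i _ => abs_nonneg _)) i (Finset.mem_univ i)
    exact abs_eq_zero.1 this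
  refine hH0 (e.toBasis.ext fun i => ?_)
  have h1 : H = D (Finset.univ \ T) := sub_eq_zero.1 hBz
  rw [h1]
  rcases i with i | i <;> simp [D, OrthonormalBasis.diag_apply, hh0]

/-! ### Nets of unit balls and seminorms of products -/

open MeasureTheory Metric in
/-- The volumetric bound for separated subsets of the unit ball. -/
theorem card_le_of_separated_of_norm_le_one {E : Type*} [NormedAddCommGroup E] [NormedSpace ℝ E]
    [FiniteDimensional ℝ E] {ε : ℝ} (hε : 0 < ε) (s : Finset E) (hs : ∀ x ∈ s, ‖x‖ ≤ 1)
    (h : ∀ x ∈ s, ∀ y ∈ s, x ≠ y → ε < ‖x - y‖) :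
    (s.card : ℝ) ≤ (1 + 2 / ε) ^ finrank ℝ E := by
  borelize E
  let μ : Measure E := Measure.addHaar
  have hδ : 0 < ε / 2 := by positivity
  have hρ : 0 < 1 + ε / 2 := by positivity
  have D : Set.Pairwise (s : Set E) (Function.onFun Disjoint fun c => ball (c : E) (ε / 2)) := by
    intro c hc d hd hcd
    refine ball_disjoint_ball ?_
    rw [dist_eq_norm]
    linarith [h c hc d hd hcd]
  have A_subset : ⋃ c ∈ s, ball (c : E) (ε / 2) ⊆ ball (0 : E) (1 + ε / 2) := by
    refine Set.iUnion₂_subset fun x hx => ball_subset_ball' ?_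
    rw [dist_zero_right]
    linarith [hs x hx]
  have I : (s.card : ENNReal) * ENNReal.ofReal ((ε / 2) ^ finrank ℝ E) * μ (ball 0 1) ≤
      ENNReal.ofReal ((1 + ε / 2) ^ finrank ℝ E) * μ (ball 0 1) :=
    calc (s.card : ENNReal) * ENNReal.ofReal ((ε / 2) ^ finrank ℝ E) * μ (ball 0 1)
        = μ (⋃ c ∈ s, ball (c : E) (ε / 2)) := by
          rw [measure_biUnion_finset D fun c _ => measurableSet_ball]
          simp only [μ.addHaar_ball_of_pos _ hδ, Finset.sum_const, nsmul_eq_mul, mul_assoc]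
      _ ≤ μ (ball (0 : E) (1 + ε / 2)) := measure_mono A_subset
      _ = _ := by simp only [μ.addHaar_ball_of_pos _ hρ]
  have J := (ENNReal.mul_le_mul_iff_left (measure_ball_pos μ _ zero_lt_one).ne'
    measure_ball_lt_top.ne).1 I
  have K := ENNReal.toReal_le_of_le_ofReal (pow_nonneg hρ.le _) J
  rw [ENNReal.toReal_mul, ENNReal.toReal_natCast, ENNReal.toReal_ofReal (by positivity),
    ← le_div_iff₀ (by positivity), ← div_pow] at K
  have hq : (1 + ε / 2) / (ε / 2) = 1 + 2 / ε := by
    field_simp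
    ring
  rwa [hq] at K

/-- A separated set of maximal cardinality is a net; the volumetric bound ensures that a maximum
exists. -/
theorem exists_finset_net_unitBall (E : Type*) [NormedAddCommGroup E] [NormedSpace ℝ E]
    [FiniteDimensional ℝ E] {ε : ℝ} (hε : 0 < ε) :
    ∃ s : Finset E, (∀ x ∈ s, ‖x‖ ≤ 1) ∧ (s.card : ℝ) ≤ (1 + 2 / ε) ^ finrank ℝ E ∧
      ∀ x : E, ‖x‖ ≤ 1 → ∃ y ∈ s, ‖x - y‖ ≤ ε := by
  classical
  let P : ℕ → Prop := fun n => ∃ s : Finset E, s.card = n ∧ (∀ x ∈ s, ‖x‖ ≤ 1) ∧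
    ∀ x ∈ s, ∀ y ∈ s, x ≠ y → ε < ‖x - y‖
  have hbound : ∀ n, P n → n ≤ ⌊(1 + 2 / ε) ^ finrank ℝ E⌋₊ := by
    rintro n ⟨s, rfl, h1, h2⟩
    exact Nat.le_floor (card_le_of_separated_of_norm_le_one hε s h1 h2)
  have hP : P (Nat.findGreatest P ⌊(1 + 2 / ε) ^ finrank ℝ E⌋₊) :=
    Nat.findGreatest_spec (Nat.zero_le _) ⟨∅, by simp, by simp, by simp⟩
  obtain ⟨s, hcard, h1, h2⟩ := hP
  refine ⟨s, h1, card_le_of_separated_of_norm_le_one hε s h1 h2, fun x hx => ?_⟩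
  by_contra! hfar
  have hxs : x ∉ s := fun h => by
    have := hfar x h
    simp at this
    linarith
  have hP' : P (s.card + 1) := by
    refine ⟨insert x s, Finset.card_insert_of_notMem hxs, ?_, ?_⟩
    · simpa using ⟨hx, h1⟩
    · intro y hy z hz hyz
      rcases Finset.mem_insert.1 hy with rfl | hy' <;> rcases Finset.mem_insert.1 hz with rfl | hz'
      · exact absurd rfl hyz
      · exact hfar z hz'
      · rw [norm_sub_rev]; exact hfar y hy'
      · exact h2 y hy' z hz' hyz
  have := Nat.le_findGreatest (hbound _ hP') hP'
  omega

section Bilinear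

variable {X Y V : Type*} [NormedAddCommGroup X] [NormedSpace ℝ X] [NormedAddCommGroup Y]
  [NormedSpace ℝ Y] [NormedAddCommGroup V] [NormedSpace ℝ V]

/-- Bounding a seminorm on all products of elements of two unit balls by its values on nets. -/
theorem seminorm_le_of_net (m : X →ₗ[ℝ] Y →ₗ[ℝ] V) (hm : ∀ q r, ‖m q r‖ ≤ ‖q‖ * ‖r‖)
    (N : Seminorm ℝ V) {L : ℝ} (hL : ∀ v, N v ≤ L * ‖v‖) {C ε : ℝ} (hε : 0 < ε) (hε' : ε ≤ 1 / 4)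
    {s : Set X} {t : Set Y}
    (hsnet : ∀ x : X, ‖x‖ ≤ 1 → ∃ y ∈ s, ‖x - y‖ ≤ ε)
    (htnet : ∀ x : Y, ‖x‖ ≤ 1 → ∃ y ∈ t, ‖x - y‖ ≤ ε) (hs : ∀ q ∈ s, ‖q‖ ≤ 1)
    (hC : ∀ q ∈ s, ∀ r ∈ t, N (m q r) ≤ C) :
    ∀ q r, ‖q‖ ≤ 1 → ‖r‖ ≤ 1 → N (m q r) ≤ 2 * C ∧
      ∃ q' ∈ s, ∃ r' ∈ t, ‖m q r - m q' r'‖ ≤ 2 * ε ∧ N (m q r - m q' r') ≤ 4 * ε * C := by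
  set S : Set ℝ := {x | ∃ q r, ‖q‖ ≤ 1 ∧ ‖r‖ ≤ 1 ∧ x = N (m q r)} with hS
  have hbdd : BddAbove S := by
    refine ⟨|L|, ?_⟩
    rintro x ⟨q, r, hq, hr, rfl⟩
    calc N (m q r) ≤ L * ‖m q r‖ := hL _
      _ ≤ |L| * 1 := mul_le_mul (le_abs_self L)
          ((hm q r).trans (mul_le_one₀ hq (norm_nonneg _) hr)) (norm_nonneg _) (abs_nonneg _)
      _ = |L| := mul_one _
  set M := sSup S with hM
  have hle : ∀ q r, ‖q‖ ≤ 1 → ‖r‖ ≤ 1 → N (m q r) ≤ M := fun q r hq hr =>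
    le_csSup hbdd ⟨q, r, hq, hr, rfl⟩
  have hle' : ∀ q r, ‖q‖ ≤ ε → ‖r‖ ≤ 1 → N (m q r) ≤ ε * M := by
    intro q r hq hr
    have h1 : q = ε • (ε⁻¹ • q) := by rw [smul_smul, mul_inv_cancel₀ hε.ne', one_smul]
    rw [h1, map_smul, LinearMap.smul_apply, map_smul_eq_mul, Real.norm_of_nonneg hε.le]
    refine mul_le_mul_of_nonneg_left (hle _ _ ?_ hr) hε.le
    rw [norm_smul, Real.norm_of_nonneg (inv_nonneg.2 hε.le), inv_mul_le_iff₀ hε, mul_one]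
    exact hq
  have hle'' : ∀ q r, ‖q‖ ≤ 1 → ‖r‖ ≤ ε → N (m q r) ≤ ε * M := by
    intro q r hq hr
    have h1 : r = ε • (ε⁻¹ • r) := by rw [smul_smul, mul_inv_cancel₀ hε.ne', one_smul]
    rw [h1, map_smul, map_smul_eq_mul, Real.norm_of_nonneg hε.le]
    refine mul_le_mul_of_nonneg_left (hle _ _ hq ?_) hε.le
    rw [norm_smul, Real.norm_of_nonneg (inv_nonneg.2 hε.le), inv_mul_le_iff₀ hε, mul_one]
    exact hr
  have key : ∀ q r, ‖q‖ ≤ 1 → ‖r‖ ≤ 1 → ∃ q' ∈ s, ∃ r' ∈ t,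
      ‖m q r - m q' r'‖ ≤ 2 * ε ∧ N (m q r - m q' r') ≤ 2 * ε * M := by
    intro q r hq hr
    obtain ⟨q', hq', hqq⟩ := hsnet q hq
    obtain ⟨r', hr', hrr⟩ := htnet r hr
    have hdec : m q r - m q' r' = m (q - q') r + m q' (r - r') := by simp
    refine ⟨q', hq', r', hr', ?_, ?_⟩
    · rw [hdec]
      refine (norm_add_le _ _).trans ?_
      have h1 := (hm (q - q') r).trans (mul_le_mul hqq hr (norm_nonneg _) hε.le)
      have h2 := (hm q' (r - r')).trans (mul_le_mul (hs q' hq') hrr (norm_nonneg _) zero_le_one)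
      linarith
    · rw [hdec]
      refine (map_add_le_add N _ _).trans ?_
      have h1 := hle' (q - q') r hqq hr
      have h2 := hle'' q' (r - r') (hs q' hq') hrr
      linarith
  have hM0 : 0 ≤ M := by
    have := hle 0 0 (by simp) (by simp)
    simpa using this
  -- The supremum bounds itself: `M ≤ C + 2εM` with `ε ≤ 1/4` yields `M ≤ 2C`. This needs `M`
  -- finite, which is what `hL` provides.
  have hMC : M ≤ C + 2 * ε * M := by
    refine csSup_le ⟨_, 0, 0, by simp, by simp, rfl⟩ ?_
    rintro x ⟨q, r, hq, hr, rfl⟩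
    obtain ⟨q', hq', r', hr', -, h2⟩ := key q r hq hr
    have h3 : m q r = m q' r' + (m q r - m q' r') := by abel
    rw [h3]
    refine (map_add_le_add N _ _).trans ?_
    exact add_le_add (hC q' hq' r' hr') h2
  have hM2 : M ≤ 2 * C := by nlinarith
  intro q r hq hr
  refine ⟨(hle q r hq hr).trans hM2, ?_⟩
  obtain ⟨q', hq', r', hr', h1, h2⟩ := key q r hq hr
  exact ⟨q', hq', r', hr', h1, h2.trans (by nlinarith)⟩

/-- Rescale so that the product has norm one; `hr` then keeps the second factor in the unit ball. A
nearby net product has norm at least `1 - 2ε`, so the lower bound is `c(1 - 2ε) - 4εC ≥ c/2`. -/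
theorem seminorm_bounds_of_net (m : X →ₗ[ℝ] Y →ₗ[ℝ] V) (hm : ∀ q r, ‖m q r‖ ≤ ‖q‖ * ‖r‖)
    (N : Seminorm ℝ V) {L : ℝ} (hL : ∀ v, N v ≤ L * ‖v‖) {c C ε : ℝ} (hc : 0 ≤ c) (hC0 : 0 ≤ C)
    (hε : 0 < ε) (hε' : ε ≤ 1 / 4) (hεc : 2 * ε * c + 4 * ε * C ≤ c / 2)
    {s : Set X} {t : Set Y} (hs : ∀ q ∈ s, ‖q‖ ≤ 1) (ht : ∀ r ∈ t, ‖r‖ ≤ 1)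
    (hsnet : ∀ x : X, ‖x‖ ≤ 1 → ∃ y ∈ s, ‖x - y‖ ≤ ε)
    (htnet : ∀ x : Y, ‖x‖ ≤ 1 → ∃ y ∈ t, ‖x - y‖ ≤ ε)
    (hN : ∀ q ∈ s, ∀ r ∈ t, c * ‖m q r‖ ≤ N (m q r) ∧ N (m q r) ≤ C * ‖m q r‖)
    (q : X) (r : Y) (hq : ‖q‖ ≤ 1) (hr : ‖r‖ = ‖m q r‖) :
    c / 2 * ‖m q r‖ ≤ N (m q r) ∧ N (m q r) ≤ 2 * C * ‖m q r‖ := by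
  have hnet := seminorm_le_of_net m hm N hL (C := C) hε hε' hsnet htnet hs
    (fun q hq r hr => (hN q hq r hr).2.trans (mul_le_of_le_one_right hC0
      ((hm q r).trans (mul_le_one₀ (hs q hq) (norm_nonneg _) (ht r hr)))))
  rcases eq_or_ne (‖m q r‖) 0 with h0 | h0
  · rw [norm_eq_zero.1 h0]; simp
  have hpos : 0 < ‖m q r‖ := lt_of_le_of_ne (norm_nonneg _) (Ne.symm h0)
  set ρ := ‖m q r‖ with hρ
  have h1 : ‖m q (ρ⁻¹ • r)‖ = 1 := by
    rw [map_smul, norm_smul, norm_inv, norm_norm, inv_mul_cancel₀ h0]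
  have h2 : ‖ρ⁻¹ • r‖ ≤ 1 := by
    rw [norm_smul, norm_inv, norm_norm, hr, inv_mul_cancel₀ h0]
  have h3 : N (m q (ρ⁻¹ • r)) = ρ⁻¹ * N (m q r) := by
    rw [map_smul, map_smul_eq_mul, norm_inv, norm_norm]
  obtain ⟨hup, q', hq', r', hr', h4, h5⟩ := hnet q _ hq h2
  have hlow : c / 2 ≤ N (m q (ρ⁻¹ • r)) := by
    have h6 := (hN q' hq' r' hr').1
    have h7 : 1 - 2 * ε ≤ ‖m q' r'‖ := by
      have := norm_sub_norm_le (m q (ρ⁻¹ • r)) (m q' r')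
      rw [h1] at this
      linarith
    have h8 : N (m q' r') ≤ N (m q (ρ⁻¹ • r)) + 4 * ε * C := by
      have := map_sub_le_add N (m q (ρ⁻¹ • r)) (m q (ρ⁻¹ • r) - m q' r')
      rw [sub_sub_cancel] at this
      linarith
    have h9 := mul_le_mul_of_nonneg_left h7 hc
    linarith
  rw [h3] at hup hlow
  constructor
  · exact (le_div_iff₀ hpos).1 (by rwa [div_eq_inv_mul (N _) ρ])
  · exact (div_le_iff₀ hpos).1 (by rwa [div_eq_inv_mul (N _) ρ])

end Bilinear

/-- The product of a matrix, as a continuous linear map, with a matrix given by its columns. -/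
noncomputable def mulColumns (p K : ℕ) :
    (EuclideanSpace ℝ (Fin K) →L[ℝ] EuclideanSpace ℝ (Fin p)) →ₗ[ℝ]
      PiLp 2 (fun _ : Fin p => EuclideanSpace ℝ (Fin K)) →ₗ[ℝ]
        PiLp 2 (fun _ : Fin p => EuclideanSpace ℝ (Fin p)) :=
  LinearMap.mk₂ ℝ (fun Q R => WithLp.toLp 2 fun j => Q (R j))
    (fun Q Q' R => by ext; simp) (fun c Q R => by ext; simp)
    (fun Q R R' => by ext; simp) (fun c Q R => by ext; simp)

theorem mulColumns_apply {p K : ℕ} (Q : EuclideanSpace ℝ (Fin K) →L[ℝ] EuclideanSpace ℝ (Fin p))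
    (R : PiLp 2 (fun _ : Fin p => EuclideanSpace ℝ (Fin K))) (j : Fin p) :
    mulColumns p K Q R j = Q (R j) := rfl

theorem norm_mulColumns_le {p K : ℕ} (Q : EuclideanSpace ℝ (Fin K) →L[ℝ] EuclideanSpace ℝ (Fin p))
    (R : PiLp 2 (fun _ : Fin p => EuclideanSpace ℝ (Fin K))) :
    ‖mulColumns p K Q R‖ ≤ ‖Q‖ * ‖R‖ := by
  rw [← abs_of_nonneg (norm_nonneg (mulColumns p K Q R)),
    ← abs_of_nonneg (mul_nonneg (norm_nonneg Q) (norm_nonneg R)), ← sq_le_sq, mul_pow,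
    PiLp.norm_sq_eq_of_L2, PiLp.norm_sq_eq_of_L2, Finset.mul_sum]
  refine Finset.sum_le_sum fun j _ => ?_
  rw [mulColumns_apply, ← mul_pow]
  exact pow_le_pow_left₀ (norm_nonneg _) (Q.le_opNorm _) 2

theorem finrank_piLp_euclideanSpace (p K : ℕ) :
    finrank ℝ (PiLp 2 (fun _ : Fin p => EuclideanSpace ℝ (Fin K))) = p * K := by
  rw [(WithLp.linearEquiv 2 ℝ (Fin p → EuclideanSpace ℝ (Fin K))).finrank_eq]
  simp [Module.finrank_pi_fintype]

theorem finrank_continuousLinearMap_euclideanSpace (p K : ℕ) :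
    finrank ℝ (EuclideanSpace ℝ (Fin K) →L[ℝ] EuclideanSpace ℝ (Fin p)) = p * K := by
  rw [← (LinearMap.toContinuousLinearMap (𝕜 := ℝ) (E := EuclideanSpace ℝ (Fin K))
    (F' := EuclideanSpace ℝ (Fin p))).finrank_eq, Module.finrank_linearMap]
  simp [mul_comm]

/-! ### Moments of Gaussian bilinear forms -/

section Gaussian

open MeasureTheory ProbabilityTheory

theorem map_inner_stdGaussian {p : ℕ} (v : EuclideanSpace ℝ (Fin p)) :
    (stdGaussian (EuclideanSpace ℝ (Fin p))).map (fun x => inner ℝ v x) =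
      gaussianReal 0 (‖v‖ ^ 2).toNNReal := by
  have h := IsGaussian.map_eq_gaussianReal (μ := stdGaussian (EuclideanSpace ℝ (Fin p)))
    (innerSL ℝ v)
  rw [integral_strongDual_stdGaussian, variance_dual_stdGaussian, innerSL_apply_norm] at h
  exact h

theorem lintegral_exp_inner_stdGaussian {p : ℕ} (v : EuclideanSpace ℝ (Fin p)) :
    ∫⁻ x, ENNReal.ofReal (Real.exp (inner ℝ v x)) ∂(stdGaussian (EuclideanSpace ℝ (Fin p))) =
      ENNReal.ofReal (Real.exp (‖v‖ ^ 2 / 2)) := by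
  have h1 : ∫⁻ t, ENNReal.ofReal (Real.exp t) ∂(gaussianReal 0 (‖v‖ ^ 2).toNNReal) =
      ENNReal.ofReal (Real.exp (‖v‖ ^ 2 / 2)) := by
    have h2 := integrable_exp_mul_gaussianReal (μ := 0) (v := (‖v‖ ^ 2).toNNReal) 1
    have h3 := congrFun (mgf_id_gaussianReal (μ := 0) (v := (‖v‖ ^ 2).toNNReal)) 1
    simp only [one_mul] at h2
    rw [← ofReal_integral_eq_lintegral_ofReal h2 (ae_of_all _ fun _ => (Real.exp_pos _).le)]
    simp only [mgf, id, one_mul] at h3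
    rw [h3]
    simp
  rw [← map_inner_stdGaussian, lintegral_map (by fun_prop) (by fun_prop)] at h1
  exact h1

theorem lintegral_sq_inner_stdGaussian {p : ℕ} (v : EuclideanSpace ℝ (Fin p)) :
    ∫⁻ x, ENNReal.ofReal (inner ℝ v x ^ 2) ∂(stdGaussian (EuclideanSpace ℝ (Fin p))) =
      ENNReal.ofReal (‖v‖ ^ 2) := by
  have h1 : ∫⁻ t, ENNReal.ofReal (t ^ 2) ∂(gaussianReal 0 (‖v‖ ^ 2).toNNReal) =
      ENNReal.ofReal (‖v‖ ^ 2) := by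
    have h2 : Integrable (fun t : ℝ => t ^ 2) (gaussianReal 0 (‖v‖ ^ 2).toNNReal) :=
      (memLp_id_gaussianReal 2).integrable_sq
    have h3 := variance_fun_id_gaussianReal (μ := 0) (v := (‖v‖ ^ 2).toNNReal)
    rw [variance_of_integral_eq_zero (by fun_prop) (by simp [integral_id_gaussianReal])] at h3
    rw [← ofReal_integral_eq_lintegral_ofReal h2 (ae_of_all _ fun _ => sq_nonneg _), h3,
      Real.coe_toNNReal _ (sq_nonneg _)]
  rw [← map_inner_stdGaussian, lintegral_map (by fun_prop) (by fun_prop)] at h1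
  exact h1

/-- The exact value is `√(4/3)`. -/
theorem lintegral_exp_sq_div_eight_gaussianReal_le :
    ∫⁻ t, ENNReal.ofReal (Real.exp (t ^ 2 / 8)) ∂(gaussianReal 0 1) ≤ 2 := by
  rw [gaussianReal_of_var_ne_zero 0 one_ne_zero,
    lintegral_withDensity_eq_lintegral_mul _ (measurable_gaussianPDF 0 1) (by fun_prop)]
  have h1 : ∀ t : ℝ, (gaussianPDF 0 1 * fun t => ENNReal.ofReal (Real.exp (t ^ 2 / 8))) t =
      ENNReal.ofReal ((√(2 * Real.pi))⁻¹ * Real.exp (-(3 / 8) * t ^ 2)) := by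
    intro t
    rw [Pi.mul_apply, gaussianPDF_def, ← ENNReal.ofReal_mul (gaussianPDFReal_nonneg _ _ _),
      gaussianPDFReal_def]
    simp only [NNReal.coe_one, mul_one, sub_zero, mul_assoc]
    rw [← Real.exp_add]
    congr 3
    ring
  simp only [h1]
  rw [← ofReal_integral_eq_lintegral_ofReal
    ((integrable_exp_neg_mul_sq (by norm_num)).const_mul _) (ae_of_all _ fun _ => by positivity),
    integral_const_mul, integral_gaussian, ← Real.sqrt_inv, ← Real.sqrt_mul (by positivity)]
  rw [show (2 : ENNReal) = ENNReal.ofReal 2 by simp]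
  refine ENNReal.ofReal_le_ofReal ?_
  rw [Real.sqrt_le_left (by norm_num)]
  have : Real.pi ≠ 0 := Real.pi_ne_zero
  field_simp
  norm_num

theorem lintegral_exp_sq_inner_stdGaussian_le {p : ℕ} (v : EuclideanSpace ℝ (Fin p))
    (hv : v = 0 ∨ ‖v‖ = 1) :
    ∫⁻ x, ENNReal.ofReal (Real.exp (inner ℝ v x ^ 2 / 8))
      ∂(stdGaussian (EuclideanSpace ℝ (Fin p))) ≤ 2 := by
  rcases hv with rfl | hv
  · simp
  · have h1 := lintegral_exp_sq_div_eight_gaussianReal_le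
    have h2 := map_inner_stdGaussian v
    rw [hv, one_pow, Real.toNNReal_one] at h2
    rw [← h2, lintegral_map (by fun_prop) (by fun_prop)] at h1
    exact h1

/-- The linear combination of the columns `B` with coefficients `y`: the matrix-vector product. -/
noncomputable def columnsMulVec {p : ℕ} (B : PiLp 2 (fun _ : Fin p => EuclideanSpace ℝ (Fin p)))
    (y : EuclideanSpace ℝ (Fin p)) : EuclideanSpace ℝ (Fin p) := ∑ j, y j • B j

/-- The bilinear form `xᵀ B y`, as a linear functional of the columns of `B`. -/
noncomputable def columnsForm {p : ℕ}
    (z : EuclideanSpace ℝ (Fin p) × EuclideanSpace ℝ (Fin p)) :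
    PiLp 2 (fun _ : Fin p => EuclideanSpace ℝ (Fin p)) →ₗ[ℝ] ℝ where
  toFun B := inner ℝ (columnsMulVec B z.2) z.1
  map_add' B B' := by simp [columnsMulVec, smul_add, Finset.sum_add_distrib, inner_add_left]
  map_smul' c B := by
    simp [columnsMulVec, smul_comm _ c, ← Finset.smul_sum, inner_smul_left]

theorem columnsForm_apply {p : ℕ} (z : EuclideanSpace ℝ (Fin p) × EuclideanSpace ℝ (Fin p))
    (B : PiLp 2 (fun _ : Fin p => EuclideanSpace ℝ (Fin p))) :
    columnsForm z B = inner ℝ (columnsMulVec B z.2) z.1 := rfl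

theorem continuous_columnsMulVec {p : ℕ}
    (B : PiLp 2 (fun _ : Fin p => EuclideanSpace ℝ (Fin p))) : Continuous (columnsMulVec B) := by
  unfold columnsMulVec
  fun_prop

theorem continuous_columnsForm {p : ℕ}
    (B : PiLp 2 (fun _ : Fin p => EuclideanSpace ℝ (Fin p))) :
    Continuous fun z => columnsForm z B := by
  simp only [columnsForm_apply]
  have := continuous_columnsMulVec B
  fun_prop

/-- The `i`-th row of the matrix with columns `B`. -/
noncomputable def rowOfColumns {p : ℕ} (B : PiLp 2 (fun _ : Fin p => EuclideanSpace ℝ (Fin p)))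
    (i : Fin p) : EuclideanSpace ℝ (Fin p) := WithLp.toLp 2 fun j => B j i

theorem norm_columnsMulVec_sq {p : ℕ} (B : PiLp 2 (fun _ : Fin p => EuclideanSpace ℝ (Fin p)))
    (y : EuclideanSpace ℝ (Fin p)) :
    ‖columnsMulVec B y‖ ^ 2 = ∑ i, inner ℝ (rowOfColumns B i) y ^ 2 := by
  rw [EuclideanSpace.norm_sq_eq]
  refine Finset.sum_congr rfl fun i _ => ?_
  rw [Real.norm_eq_abs, sq_abs]
  simp [columnsMulVec, rowOfColumns, PiLp.inner_apply]

theorem sum_norm_rowOfColumns_sq {p : ℕ}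
    (B : PiLp 2 (fun _ : Fin p => EuclideanSpace ℝ (Fin p))) :
    ∑ i, ‖rowOfColumns B i‖ ^ 2 = ‖B‖ ^ 2 := by
  rw [PiLp.norm_sq_eq_of_L2]
  simp only [EuclideanSpace.norm_sq_eq]
  exact Finset.sum_comm

theorem lintegral_columnsForm_sq {p : ℕ}
    (B : PiLp 2 (fun _ : Fin p => EuclideanSpace ℝ (Fin p))) :
    ∫⁻ z, ENNReal.ofReal (columnsForm z B ^ 2) ∂((stdGaussian (EuclideanSpace ℝ (Fin p))).prod
      (stdGaussian (EuclideanSpace ℝ (Fin p)))) = ENNReal.ofReal (‖B‖ ^ 2) := by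
  have hc := continuous_columnsForm B
  rw [lintegral_prod_symm _ (by fun_prop)]
  simp only [columnsForm_apply, lintegral_sq_inner_stdGaussian, norm_columnsMulVec_sq]
  simp_rw [ENNReal.ofReal_sum_of_nonneg fun i _ => sq_nonneg (inner ℝ (rowOfColumns B i) _)]
  rw [lintegral_finsetSum _ (fun i _ => by fun_prop)]
  simp only [lintegral_sq_inner_stdGaussian]
  rw [← ENNReal.ofReal_sum_of_nonneg fun i _ => sq_nonneg _, sum_norm_rowOfColumns_sq]

/-- Jensen's inequality: the squared row norms sum to one, so `‖By‖²` is a convex combination of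
squares of `y` in the row directions. A zero row has direction `0`, since `0⁻¹ = 0`; hence the case
`v = 0` in `lintegral_exp_sq_inner_stdGaussian_le`. -/
theorem exp_norm_columnsMulVec_sq_le {p : ℕ}
    (B : PiLp 2 (fun _ : Fin p => EuclideanSpace ℝ (Fin p))) (hB : ‖B‖ = 1)
    (y : EuclideanSpace ℝ (Fin p)) :
    Real.exp (‖columnsMulVec B y‖ ^ 2 / 8) ≤ ∑ i, ‖rowOfColumns B i‖ ^ 2 *
      Real.exp (inner ℝ (‖rowOfColumns B i‖⁻¹ • rowOfColumns B i) y ^ 2 / 8) := by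
  have h1 : ∑ i, ‖rowOfColumns B i‖ ^ 2 = 1 := by rw [sum_norm_rowOfColumns_sq, hB, one_pow]
  have h2 := convexOn_exp.map_sum_le (t := Finset.univ) (w := fun i => ‖rowOfColumns B i‖ ^ 2)
    (p := fun i => inner ℝ (‖rowOfColumns B i‖⁻¹ • rowOfColumns B i) y ^ 2 / 8)
    (fun i _ => sq_nonneg _) h1 (fun i _ => Set.mem_univ _)
  simp only [smul_eq_mul] at h2
  refine le_trans (le_of_eq (congrArg Real.exp ?_)) h2
  rw [norm_columnsMulVec_sq, Finset.sum_div]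
  refine Finset.sum_congr rfl fun i _ => ?_
  rcases eq_or_ne (rowOfColumns B i) 0 with h0 | h0
  · simp [h0]
  · have : ‖rowOfColumns B i‖ ≠ 0 := norm_ne_zero_iff.2 h0
    rw [inner_smul_left]
    simp
    field_simp

/-- For fixed `y` the form is Gaussian in `x` with variance `‖By‖²`, and `e^{|t|/2} ≤ e^{t/2} +
e^{-t/2}` gives `2 e^{‖By‖²/8}`. Integrating over `y` costs another factor `2`. -/
theorem lintegral_exp_abs_columnsForm_le {p : ℕ}
    (B : PiLp 2 (fun _ : Fin p => EuclideanSpace ℝ (Fin p))) (hB : ‖B‖ = 1) :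
    ∫⁻ z, ENNReal.ofReal (Real.exp (|columnsForm z B| / 2))
      ∂((stdGaussian (EuclideanSpace ℝ (Fin p))).prod
      (stdGaussian (EuclideanSpace ℝ (Fin p)))) ≤ 4 := by
  have hc := continuous_columnsForm B
  have hcm := continuous_columnsMulVec B
  rw [lintegral_prod_symm _ (by fun_prop)]
  have hinner : ∀ y : EuclideanSpace ℝ (Fin p),
      ∫⁻ x, ENNReal.ofReal (Real.exp (|columnsForm (x, y) B| / 2))
        ∂(stdGaussian (EuclideanSpace ℝ (Fin p))) ≤
      2 * ENNReal.ofReal (Real.exp (‖columnsMulVec B y‖ ^ 2 / 8)) := by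
    intro y
    have h1 : ∀ x : EuclideanSpace ℝ (Fin p),
        ENNReal.ofReal (Real.exp (|columnsForm (x, y) B| / 2)) ≤
        ENNReal.ofReal (Real.exp (inner ℝ ((1 / 2 : ℝ) • columnsMulVec B y) x)) +
        ENNReal.ofReal (Real.exp (inner ℝ ((-1 / 2 : ℝ) • columnsMulVec B y) x)) := by
      intro x
      rw [← ENNReal.ofReal_add (Real.exp_pos _).le (Real.exp_pos _).le]
      refine ENNReal.ofReal_le_ofReal ?_
      rw [columnsForm_apply, inner_smul_left, inner_smul_left]
      simp only [conj_trivial]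
      rcases abs_cases (inner ℝ (columnsMulVec B y) x) with ⟨h, -⟩ | ⟨h, -⟩ <;> rw [h]
      · refine le_add_of_le_of_nonneg (Real.exp_le_exp.2 (by linarith)) (Real.exp_pos _).le
      · refine le_add_of_nonneg_of_le (Real.exp_pos _).le (Real.exp_le_exp.2 (by linarith))
    refine (lintegral_mono h1).trans (le_of_eq ?_)
    rw [lintegral_add_left (by fun_prop), lintegral_exp_inner_stdGaussian,
      lintegral_exp_inner_stdGaussian, two_mul]
    congr 3 <;> rw [norm_smul, mul_pow] <;> norm_num <;> ring
  refine (lintegral_mono hinner).trans ?_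
  rw [lintegral_const_mul _ (by fun_prop)]
  have hrow : ∫⁻ y, ENNReal.ofReal (Real.exp (‖columnsMulVec B y‖ ^ 2 / 8))
      ∂(stdGaussian (EuclideanSpace ℝ (Fin p))) ≤ 2 := by
    refine (lintegral_mono fun y =>
      ENNReal.ofReal_le_ofReal (exp_norm_columnsMulVec_sq_le B hB y)).trans ?_
    simp_rw [ENNReal.ofReal_sum_of_nonneg fun i _ =>
      mul_nonneg (sq_nonneg ‖rowOfColumns B i‖) (Real.exp_pos _).le,
      ENNReal.ofReal_mul (sq_nonneg ‖rowOfColumns B _‖)]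
    rw [lintegral_finsetSum _ (fun i _ => by fun_prop)]
    calc _ ≤ ∑ i, ENNReal.ofReal (‖rowOfColumns B i‖ ^ 2) * 2 := by
          refine Finset.sum_le_sum fun i _ => ?_
          rw [lintegral_const_mul _ (by fun_prop)]
          refine mul_le_mul_right (lintegral_exp_sq_inner_stdGaussian_le _ ?_) _
          rcases eq_or_ne (rowOfColumns B i) 0 with h0 | h0
          · left; simp [h0]
          · right; rw [norm_smul, norm_inv, norm_norm, inv_mul_cancel₀ (norm_ne_zero_iff.2 h0)]
      _ = 2 := by
          rw [← Finset.sum_mul, ← ENNReal.ofReal_sum_of_nonneg fun i _ => sq_nonneg _,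
            sum_norm_rowOfColumns_sq, hB]
          simp
  calc _ ≤ (2 : ENNReal) * 2 := mul_le_mul_right hrow _
    _ = 4 := by norm_num

/-- This bounds a negative exponential moment by the second moment and a positive exponential
moment. It combines `e^{-u} ≤ 1 - u + u²/2` at `u = t/64` with `e^{t/2} ≥ t⁴/384`; for `v = t/32`
the remaining gap is `v (v - 1)² (v + 2) / 4 ≥ 0`. -/
theorem exp_neg_abs_div_le (y : ℝ) : Real.exp (-|y| / 64) ≤
    1 - 5 / 8192 * y ^ 2 + 3 / 32768 * Real.exp (|y| / 2) := by
  set t := |y| with ht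
  have ht0 : 0 ≤ t := abs_nonneg y
  have hy : y ^ 2 = t ^ 2 := (sq_abs y).symm
  have h1 : Real.exp (-t / 64) ≤ 1 - t / 64 + t ^ 2 / 8192 := by
    have h := Real.quadratic_le_exp_of_nonneg (x := t / 64) (by positivity)
    rw [neg_div, Real.exp_neg, inv_le_iff_one_le_mul₀ (Real.exp_pos _)]
    have h0 : 0 ≤ 1 - t / 64 + t ^ 2 / 8192 := by nlinarith [sq_nonneg (t / 64 - 1)]
    refine le_trans ?_ (mul_le_mul_of_nonneg_left h h0)
    nlinarith [pow_nonneg ht0 4]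
  have h2 : (t / 2) ^ 4 / 24 ≤ Real.exp (t / 2) := by
    have := Real.pow_div_factorial_le_exp (t / 2) (by positivity) 4
    simpa [Nat.factorial] using this
  have h3 : 0 ≤ t * ((t / 32 - 1) ^ 2 * (t / 32 + 2)) := by positivity
  rw [hy]
  nlinarith

end Gaussian

/-! ### Concentration, uniformly over low-rank matrices -/

section Tail

open MeasureTheory ProbabilityTheory

theorem lintegral_exp_neg_abs_columnsForm_le {p : ℕ}
    (B : PiLp 2 (fun _ : Fin p => EuclideanSpace ℝ (Fin p))) (hB : ‖B‖ = 1) :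
    ∫⁻ z, ENNReal.ofReal (Real.exp (-|columnsForm z B| / 64))
      ∂((stdGaussian (EuclideanSpace ℝ (Fin p))).prod
      (stdGaussian (EuclideanSpace ℝ (Fin p)))) ≤ ENNReal.ofReal (Real.exp (-1 / 4096)) := by
  have hc := continuous_columnsForm B
  set μ := (stdGaussian (EuclideanSpace ℝ (Fin p))).prod (stdGaussian (EuclideanSpace ℝ (Fin p)))
  -- The negative quadratic term stands on the left so that nothing is subtracted under the
  -- integral. The final count is `1 - 5/8192 + 4 · 3/32768 = 1 - 1/4096`.
  have h1 : ∫⁻ z, (ENNReal.ofReal (Real.exp (-|columnsForm z B| / 64)) +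
      ENNReal.ofReal (5 / 8192) * ENNReal.ofReal (columnsForm z B ^ 2)) ∂μ ≤
      ∫⁻ z, (1 + ENNReal.ofReal (3 / 32768) *
        ENNReal.ofReal (Real.exp (|columnsForm z B| / 2))) ∂μ := by
    refine lintegral_mono fun z => ?_
    simp only
    rw [← ENNReal.ofReal_mul (by norm_num), ← ENNReal.ofReal_mul (by norm_num),
      ← ENNReal.ofReal_add (Real.exp_pos _).le (by positivity), ← ENNReal.ofReal_one,
      ← ENNReal.ofReal_add (by norm_num) (by positivity)]
    refine ENNReal.ofReal_le_ofReal ?_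
    linarith [exp_neg_abs_div_le (columnsForm z B)]
  rw [lintegral_add_left (by fun_prop), lintegral_const_mul _ (by fun_prop),
    lintegral_columnsForm_sq, hB, lintegral_add_left (by fun_prop),
    lintegral_const_mul _ (by fun_prop), lintegral_const, measure_univ, one_pow,
    ENNReal.ofReal_one, mul_one, mul_one] at h1
  have h2 : (1 : ENNReal) + ENNReal.ofReal (3 / 32768) *
      ∫⁻ z, ENNReal.ofReal (Real.exp (|columnsForm z B| / 2)) ∂μ ≤
      ENNReal.ofReal (1 + 12 / 32768) := by
    rw [ENNReal.ofReal_add (by norm_num) (by norm_num), ENNReal.ofReal_one]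
    refine add_le_add_right ?_ _
    refine (mul_le_mul_right (lintegral_exp_abs_columnsForm_le B hB) _).trans (le_of_eq ?_)
    rw [show (4 : ENNReal) = ENNReal.ofReal 4 by simp, ← ENNReal.ofReal_mul (by norm_num)]
    norm_num
  refine (ENNReal.le_sub_of_add_le_right ENNReal.ofReal_ne_top (h1.trans h2)).trans ?_
  rw [← ENNReal.ofReal_sub _ (by norm_num)]
  refine ENNReal.ofReal_le_ofReal ?_
  have := Real.add_one_le_exp (-1 / 4096 : ℝ)
  linarith

theorem lintegral_pi_prod_apply {Z : Type*} [MeasurableSpace Z] (μ : Measure Z)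
    [IsProbabilityMeasure μ] (m : ℕ) {f : Z → ENNReal} (hf : Measurable f) :
    ∫⁻ z, ∏ i, f (z i) ∂(Measure.pi fun _ : Fin m => μ) = (∫⁻ x, f x ∂μ) ^ m := by
  have hind : iIndepFun (fun (i : Fin m) (z : Fin m → Z) => f (z i))
      (Measure.pi fun _ : Fin m => μ) := iIndepFun_pi (fun _ => hf.aemeasurable)
  rw [lintegral_prod_eq_prod_lintegral_of_indepFun Finset.univ _ hind
    (fun i => hf.comp (measurable_pi_apply i))]
  have : ∀ i : Fin m, ∫⁻ z, f (z i) ∂(Measure.pi fun _ : Fin m => μ) = ∫⁻ x, f x ∂μ := by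
    intro i
    exact (measurePreserving_eval (fun _ : Fin m => μ) i).lintegral_comp hf
  simp [this]

/-- The exponential Markov inequality for sums of independent copies. -/
theorem measure_pi_le_of_lintegral_exp_le {Z : Type*} [MeasurableSpace Z] (μ : Measure Z)
    [IsProbabilityMeasure μ] (m : ℕ) {f : Z → ℝ} (hf : Measurable f) {a : ℝ}
    (h : ∫⁻ x, ENNReal.ofReal (Real.exp (f x)) ∂μ ≤ ENNReal.ofReal (Real.exp a)) (b : ℝ) :
    (Measure.pi fun _ : Fin m => μ) {z | b ≤ ∑ i, f (z i)} ≤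
      ENNReal.ofReal (Real.exp (m * a - b)) := by
  have h1 := lintegral_pi_prod_apply μ m (f := fun x => ENNReal.ofReal (Real.exp (f x)))
    (by fun_prop)
  have hsub : {z : Fin m → Z | b ≤ ∑ i, f (z i)} ⊆ {z | ENNReal.ofReal (Real.exp b) ≤
      ∏ i, ENNReal.ofReal (Real.exp (f (z i)))} := by
    intro z hz
    simp only [Set.mem_ofPred_eq] at hz ⊢
    rw [← ENNReal.ofReal_prod_of_nonneg (fun i _ => (Real.exp_pos _).le), ← Real.exp_sum]
    exact ENNReal.ofReal_le_ofReal (Real.exp_le_exp.2 hz)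
  have h2 := mul_meas_ge_le_lintegral (μ := Measure.pi fun _ : Fin m => μ)
    (f := fun z : Fin m → Z => ∏ i, ENNReal.ofReal (Real.exp (f (z i)))) (by fun_prop)
    (ENNReal.ofReal (Real.exp b))
  rw [h1] at h2
  have hb : ENNReal.ofReal (Real.exp b) ≠ 0 := by simp [Real.exp_pos]
  refine (measure_mono hsub).trans ?_
  rw [Real.exp_sub, ENNReal.ofReal_div_of_pos (Real.exp_pos _),
    ENNReal.le_div_iff_mul_le (Or.inl hb) (Or.inl ENNReal.ofReal_ne_top), mul_comm]
  refine h2.trans ?_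
  rw [mul_comm (m : ℝ) a, Real.exp_mul, Real.rpow_natCast, ENNReal.ofReal_pow (Real.exp_pos _).le]
  exact pow_le_pow_left' h m

/-- The `ℓ¹` norm of the values of the forms `columnsForm (z i)`. -/
noncomputable def sumAbsForm {m p : ℕ}
    (z : Fin m → EuclideanSpace ℝ (Fin p) × EuclideanSpace ℝ (Fin p)) :
    Seminorm ℝ (PiLp 2 (fun _ : Fin p => EuclideanSpace ℝ (Fin p))) :=
  Seminorm.of (fun B => ∑ i, |columnsForm (z i) B|)
    (fun B B' => by
      rw [← Finset.sum_add_distrib]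
      exact Finset.sum_le_sum fun i _ => by rw [map_add]; exact abs_add_le _ _)
    (fun c B => by
      simp [abs_mul, Finset.mul_sum])

theorem sumAbsForm_apply {m p : ℕ}
    (z : Fin m → EuclideanSpace ℝ (Fin p) × EuclideanSpace ℝ (Fin p))
    (B : PiLp 2 (fun _ : Fin p => EuclideanSpace ℝ (Fin p))) :
    sumAbsForm z B = ∑ i, |columnsForm (z i) B| := rfl

theorem LinearMap.exists_abs_le_mul_norm {V : Type*} [NormedAddCommGroup V] [NormedSpace ℝ V]
    [FiniteDimensional ℝ V] (f : V →ₗ[ℝ] ℝ) : ∃ L : ℝ, ∀ v, |f v| ≤ L * ‖v‖ :=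
  ⟨‖LinearMap.toContinuousLinearMap f‖, (LinearMap.toContinuousLinearMap f).le_opNorm⟩

theorem exists_sumAbsForm_le {m p : ℕ}
    (z : Fin m → EuclideanSpace ℝ (Fin p) × EuclideanSpace ℝ (Fin p)) :
    ∃ L : ℝ, ∀ B, sumAbsForm z B ≤ L * ‖B‖ := by
  choose L hL using fun i => (columnsForm (z i)).exists_abs_le_mul_norm
  refine ⟨∑ i, L i, fun B => ?_⟩
  rw [sumAbsForm_apply, Finset.sum_mul]
  exact Finset.sum_le_sum fun i _ => hL i B

theorem measurable_sumAbsForm {m p : ℕ} (B : PiLp 2 (fun _ : Fin p => EuclideanSpace ℝ (Fin p))) :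
    Measurable fun z : Fin m → EuclideanSpace ℝ (Fin p) × EuclideanSpace ℝ (Fin p) =>
      sumAbsForm z B := by
  simp only [sumAbsForm_apply]
  have := (continuous_columnsForm B).measurable
  fun_prop

/-- After normalizing `B`, the exponents are `-m/4096 + m/8192` for the lower tail and `2m - 3m` for
the upper one, using `4 ≤ e²`. -/
theorem measure_sumAbsForm_not_bounded_le {m p : ℕ}
    (B : PiLp 2 (fun _ : Fin p => EuclideanSpace ℝ (Fin p))) :
    (Measure.pi fun _ : Fin m => (stdGaussian (EuclideanSpace ℝ (Fin p))).prod
      (stdGaussian (EuclideanSpace ℝ (Fin p))))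
      {z | ¬(m / 128 * ‖B‖ ≤ sumAbsForm z B ∧ sumAbsForm z B ≤ 6 * m * ‖B‖)} ≤
      ENNReal.ofReal (2 * Real.exp (-(m : ℝ) / 8192)) := by
  rcases eq_or_ne B 0 with rfl | hB0
  · simp
  have hpos : 0 < ‖B‖ := norm_pos_iff.2 hB0
  set B' := ‖B‖⁻¹ • B with hB'
  have hn : ‖B'‖ = 1 := by rw [hB', norm_smul, norm_inv, norm_norm, inv_mul_cancel₀ hpos.ne']
  have hmeas : Measurable fun z => |columnsForm z B'| :=
    (continuous_columnsForm B').measurable.abs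
  have hlow := measure_pi_le_of_lintegral_exp_le _ m (f := fun z => -|columnsForm z B'| / 64)
    (by fun_prop) (lintegral_exp_neg_abs_columnsForm_le B' hn) (-(m : ℝ) / 8192)
  have h4 : (4 : ENNReal) ≤ ENNReal.ofReal (Real.exp 2) := by
    rw [show (4 : ENNReal) = ENNReal.ofReal 4 by simp]
    refine ENNReal.ofReal_le_ofReal ?_
    have := Real.quadratic_le_exp_of_nonneg (x := 2) (by norm_num)
    linarith
  have hup := measure_pi_le_of_lintegral_exp_le _ m (f := fun z => |columnsForm z B'| / 2)
    (by fun_prop) ((lintegral_exp_abs_columnsForm_le B' hn).trans h4) (3 * m)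
  have hscale : ∀ z : Fin m → EuclideanSpace ℝ (Fin p) × EuclideanSpace ℝ (Fin p),
      sumAbsForm z B = ‖B‖ * sumAbsForm z B' := by
    intro z
    rw [hB', map_smul_eq_mul, norm_inv, norm_norm, mul_inv_cancel_left₀ hpos.ne']
  have hsub : {z : Fin m → EuclideanSpace ℝ (Fin p) × EuclideanSpace ℝ (Fin p) |
      ¬(m / 128 * ‖B‖ ≤ sumAbsForm z B ∧ sumAbsForm z B ≤ 6 * m * ‖B‖)} ⊆
      {z | -(m : ℝ) / 8192 ≤ ∑ i, -|columnsForm (z i) B'| / 64} ∪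
      {z | 3 * (m : ℝ) ≤ ∑ i, |columnsForm (z i) B'| / 2} := by
    intro z hz
    simp only [Set.mem_ofPred_eq, not_and_or, not_le, Set.mem_union] at hz ⊢
    rw [← Finset.sum_div, ← Finset.sum_div, Finset.sum_neg_distrib, ← sumAbsForm_apply]
    rw [hscale] at hz
    rcases hz with hz | hz
    · left
      have : sumAbsForm z B' < m / 128 := by
        rw [mul_comm] at hz
        exact lt_of_mul_lt_mul_right hz hpos.le
      linarith
    · right
      have : 6 * m < sumAbsForm z B' := by
        rw [mul_comm ‖B‖] at hz
        exact lt_of_mul_lt_mul_right hz hpos.le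
      linarith
  refine (measure_mono hsub).trans ((measure_union_le _ _).trans ((add_le_add hlow hup).trans ?_))
  rw [← ENNReal.ofReal_add (Real.exp_pos _).le (Real.exp_pos _).le]
  refine ENNReal.ofReal_le_ofReal ?_
  have hm : (0 : ℝ) ≤ m := Nat.cast_nonneg m
  have e1 : Real.exp ((m : ℝ) * (-1 / 4096) - -(m : ℝ) / 8192) ≤ Real.exp (-(m : ℝ) / 8192) :=
    Real.exp_le_exp.2 (by linarith)
  have e2 : Real.exp ((m : ℝ) * 2 - 3 * m) ≤ Real.exp (-(m : ℝ) / 8192) :=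
    Real.exp_le_exp.2 (by linarith)
  linarith

/-- With high probability the `ℓ¹` norm of the values of Gaussian forms is uniformly comparable to
the Frobenius norm on matrices of rank at most `K`. -/
theorem exists_event_sumAbsForm_bounds {m p K : ℕ}
    (h : 20 * ((p : ℝ) * K) + 1 ≤ (m : ℝ) / 16384) :
    ∃ G : Set (Fin m → EuclideanSpace ℝ (Fin p) × EuclideanSpace ℝ (Fin p)), MeasurableSet G ∧
      (Measure.pi fun _ : Fin m => (stdGaussian (EuclideanSpace ℝ (Fin p))).prod
        (stdGaussian (EuclideanSpace ℝ (Fin p)))) Gᶜ ≤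
          ENNReal.ofReal (Real.exp (-(m : ℝ) / 16384)) ∧
      ∀ z ∈ G, ∀ (T : EuclideanSpace ℝ (Fin p) →ₗ[ℝ] EuclideanSpace ℝ (Fin p))
        (W : Submodule ℝ (EuclideanSpace ℝ (Fin p))), (∀ x, T x ∈ W) → finrank ℝ W ≤ K →
        m / 256 * ‖columns T‖ ≤ sumAbsForm z (columns T) ∧
          sumAbsForm z (columns T) ≤ 12 * m * ‖columns T‖ := by
  -- For `c = m/128` and `C = 6m`, `ε = 1/8000` is small enough for `2εc + 4εC ≤ c/2`. Both factor
  -- spaces have dimension `pK` and `1 + 2/ε = 16001 ≤ e¹⁰`, so there are at most `e^{20pK}` pairs.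
  obtain ⟨s, hs, hscard, hsnet⟩ := exists_finset_net_unitBall
    (EuclideanSpace ℝ (Fin K) →L[ℝ] EuclideanSpace ℝ (Fin p)) (ε := 1 / 8000) (by norm_num)
  obtain ⟨t, ht, htcard, htnet⟩ := exists_finset_net_unitBall
    (PiLp 2 (fun _ : Fin p => EuclideanSpace ℝ (Fin K))) (ε := 1 / 8000) (by norm_num)
  rw [finrank_continuousLinearMap_euclideanSpace] at hscard
  rw [finrank_piLp_euclideanSpace] at htcard
  have hbase : (1 + 2 / (1 / 8000) : ℝ) ≤ Real.exp 10 := by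
    have := Real.exp_one_gt_d9
    have h1 : Real.exp 10 = Real.exp 1 ^ 10 := by
      rw [← Real.exp_nat_mul]; norm_num
    rw [h1]
    calc (1 + 2 / (1 / 8000) : ℝ) ≤ (2.7 : ℝ) ^ 10 := by norm_num
      _ ≤ Real.exp 1 ^ 10 := pow_le_pow_left₀ (by norm_num) (by linarith) 10
  have hcard : ∀ x : ℝ, x ≤ (1 + 2 / (1 / 8000)) ^ (p * K) → x ≤ Real.exp (10 * ((p : ℝ) * K)) := by
    intro x hx
    refine hx.trans ((pow_le_pow_left₀ (by norm_num) hbase _).trans (le_of_eq ?_))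
    rw [← Real.exp_nat_mul]
    push_cast
    ring_nf
  let bad : (EuclideanSpace ℝ (Fin K) →L[ℝ] EuclideanSpace ℝ (Fin p)) ×
      PiLp 2 (fun _ : Fin p => EuclideanSpace ℝ (Fin K)) →
      Set (Fin m → EuclideanSpace ℝ (Fin p) × EuclideanSpace ℝ (Fin p)) := fun x =>
    {z | ¬(m / 128 * ‖mulColumns p K x.1 x.2‖ ≤ sumAbsForm z (mulColumns p K x.1 x.2) ∧
      sumAbsForm z (mulColumns p K x.1 x.2) ≤ 6 * m * ‖mulColumns p K x.1 x.2‖)}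
  refine ⟨(⋃ x ∈ s ×ˢ t, bad x)ᶜ, ?_, ?_, ?_⟩
  · refine (Finset.measurableSet_biUnion _ fun x _ => ?_).compl
    have := measurable_sumAbsForm (m := m) (mulColumns p K x.1 x.2)
    exact ((measurableSet_le measurable_const this).inter
      (measurableSet_le this measurable_const)).compl
  · rw [compl_compl]
    refine (measure_biUnion_finset_le _ _).trans ?_
    refine (Finset.sum_le_sum fun x _ => measure_sumAbsForm_not_bounded_le _).trans ?_
    rw [Finset.sum_const, Finset.card_product, nsmul_eq_mul, ← ENNReal.ofReal_natCast,
      ← ENNReal.ofReal_mul (by positivity)]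
    refine ENNReal.ofReal_le_ofReal ?_
    push_cast
    have h2 : (2 : ℝ) ≤ Real.exp 1 := by linarith [Real.exp_one_gt_d9]
    calc (s.card : ℝ) * t.card * (2 * Real.exp (-(m : ℝ) / 8192))
        ≤ Real.exp (10 * ((p : ℝ) * K)) * Real.exp (10 * ((p : ℝ) * K)) *
          (Real.exp 1 * Real.exp (-(m : ℝ) / 8192)) := by
          gcongr
          · exact hcard _ hscard
          · exact hcard _ htcard
      _ = Real.exp (20 * ((p : ℝ) * K) + 1 - m / 8192) := by
          rw [← Real.exp_add, ← Real.exp_add, ← Real.exp_add]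
          ring_nf
      _ ≤ _ := Real.exp_le_exp.2 (by linarith)
  · intro z hz T W hTW hW
    obtain ⟨Q, R, hQ, hR, hQR⟩ := exists_factorization_of_range_le T W hTW hW
    obtain ⟨L, hL⟩ := exists_sumAbsForm_le z
    have hT : columns T = mulColumns p K Q R := by
      ext1 j
      exact hQR j
    have hm : (0 : ℝ) ≤ m := Nat.cast_nonneg m
    have key := seminorm_bounds_of_net (mulColumns p K) norm_mulColumns_le (sumAbsForm z) hL
      (c := m / 128) (C := 6 * m) (ε := 1 / 8000) (by positivity) (by positivity) (by norm_num)
      (by norm_num) (by linarith) (s := s) (t := t) hs ht hsnet htnet ?_ Q R hQ (by rw [← hT, hR])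
    · rw [hT]
      refine ⟨le_trans (le_of_eq ?_) key.1, key.2.trans (le_of_eq ?_)⟩ <;> ring
    · intro q hq r hr
      by_contra hbad
      exact hz (Set.mem_iUnion₂.2 ⟨(q, r), Finset.mem_product.2 ⟨hq, hr⟩, hbad⟩)

end Tail

/-! ### From seminorm bounds to exact recovery -/

section Recovery

theorem isSymmetric_toEuclideanLin_of_isSymm {p : ℕ} {A : Matrix (Fin p) (Fin p) ℝ}
    (hA : A.IsSymm) : (Matrix.toEuclideanLin A).IsSymmetric := by
  refine Matrix.isSymmetric_toEuclideanLin_iff.2 ?_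
  rw [Matrix.IsHermitian, Matrix.conjTranspose_eq_transpose_of_trivial, hA]

theorem finrank_range_toEuclideanLin {p : ℕ} (A : Matrix (Fin p) (Fin p) ℝ) :
    finrank ℝ (LinearMap.range (Matrix.toEuclideanLin A)) = A.rank :=
  (Matrix.rank_eq_finrank_range_toLin A (EuclideanSpace.basisFun (Fin p) ℝ).toBasis
    (EuclideanSpace.basisFun (Fin p) ℝ).toBasis).symm

theorem nuclearNorm_nonneg {p : ℕ} (A : Matrix (Fin p) (Fin p) ℝ) : 0 ≤ nuclearNorm A :=
  Finset.sum_nonneg fun _ _ => LinearMap.singularValues_nonneg _ _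

theorem nuclearNorm_zero {p : ℕ} : nuclearNorm (0 : Matrix (Fin p) (Fin p) ℝ) = 0 := by
  simp [nuclearNorm]

theorem nuclearNorm_eq_zero_iff {p : ℕ} {A : Matrix (Fin p) (Fin p) ℝ} :
    nuclearNorm A = 0 ↔ A = 0 := by
  refine ⟨fun h => ?_, fun h => by rw [h, nuclearNorm_zero]⟩
  have h1 := (Finset.sum_eq_zero_iff_of_nonneg
    (fun (i : Fin p) _ => (Matrix.toEuclideanLin A).singularValues_nonneg i)).1 h
  have h2 : (Matrix.toEuclideanLin A).singularValues = 0 := by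
    ext i
    by_cases hi : i < p
    · simpa using h1 ⟨i, hi⟩ (Finset.mem_univ _)
    · simpa using (Matrix.toEuclideanLin A).singularValues_of_finrank_le (i := i) (by simpa using hi)
  exact (LinearEquiv.map_eq_zero_iff _).1 ((LinearMap.singularValues_eq_zero_iff _).1 h2)

theorem recoversSymmetric_of_forall_lt {n p r : ℕ}
    {X : Matrix (Fin p) (Fin p) ℝ →ₗ[ℝ] (Fin n → ℝ)}
    (h : ∀ A H : Matrix (Fin p) (Fin p) ℝ, A.IsSymm → A.rank ≤ r → H.IsSymm → X H = 0 → H ≠ 0 →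
      nuclearNorm A < nuclearNorm (A + H)) : RecoversSymmetric X r := by
  have key : ∀ A M : Matrix (Fin p) (Fin p) ℝ, A.IsSymm → A.rank ≤ r → M.IsSymm → X M = X A →
      M ≠ A → nuclearNorm A < nuclearNorm M := by
    intro A M hA hr hM hX hne
    have := h A (M - A) hA hr (hM.sub hA) (by rw [map_sub, hX, sub_self]) (sub_ne_zero.2 hne)
    rwa [add_sub_cancel] at this
  intro A hA hr
  refine Set.eq_singleton_iff_unique_mem.2 ⟨⟨⟨hA, rfl⟩, fun M hM hX => ?_⟩, fun M hM => ?_⟩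
  · rcases eq_or_ne M A with rfl | hne
    · exact le_rfl
    · exact (key A M hA hr hM hX hne).le
  · by_contra hne
    exact absurd (hM.2 A hA rfl) (not_le.2 (key A M hA hr hM.1.1 hM.1.2 hne))

/-- For `r = 0` the hypothesis `n ≥ C r p` says nothing, so recovery must hold for every map: zero
is the only matrix of nuclear norm zero. -/
theorem recoversSymmetric_zero {n p : ℕ} (X : Matrix (Fin p) (Fin p) ℝ →ₗ[ℝ] (Fin n → ℝ)) :
    RecoversSymmetric X 0 := by
  refine recoversSymmetric_of_forall_lt fun A H _ hr _ _ hH => ?_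
  have hA : A = 0 := by
    have h := Nat.le_zero.1 hr
    rw [← finrank_range_toEuclideanLin, Submodule.finrank_eq_zero, LinearMap.range_eq_bot] at h
    exact (LinearEquiv.map_eq_zero_iff _).1 h
  rw [hA, zero_add, nuclearNorm_zero]
  exact lt_of_le_of_ne (nuclearNorm_nonneg H) fun h => hH (nuclearNorm_eq_zero_iff.1 h.symm)

/-- Exact recovery from two-sided bounds for a seminorm that vanishes on the kernel of the
measurement map. -/
theorem recoversSymmetric_of_seminorm_bounds {n p r s : ℕ} {c C : ℝ} (hC : 0 ≤ C) (hs : 0 < s)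
    (hCc : C * √r < c * √s) (X : Matrix (Fin p) (Fin p) ℝ →ₗ[ℝ] (Fin n → ℝ))
    (N : Seminorm ℝ (PiLp 2 (fun _ : Fin p => EuclideanSpace ℝ (Fin p))))
    (hN : ∀ (T : EuclideanSpace ℝ (Fin p) →ₗ[ℝ] EuclideanSpace ℝ (Fin p))
      (W : Submodule ℝ (EuclideanSpace ℝ (Fin p))), (∀ x, T x ∈ W) → finrank ℝ W ≤ 2 * r + s →
      c * ‖columns T‖ ≤ N (columns T) ∧ N (columns T) ≤ C * ‖columns T‖)
    (hker : ∀ H : Matrix (Fin p) (Fin p) ℝ, H.IsSymm → X H = 0 →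
      N (columns (Matrix.toEuclideanLin H)) = 0) : RecoversSymmetric X r := by
  refine recoversSymmetric_of_forall_lt fun A H hA hr hH hX hne => ?_
  obtain ⟨a, b, e, α, ha, hα, hα0, hdiag⟩ := exists_eigenbasis_diagonalizing_compression _ _
    (isSymmetric_toEuclideanLin_of_isSymm hA) (isSymmetric_toEuclideanLin_of_isSymm hH)
  rw [finrank_range_toEuclideanLin] at ha
  refine nuclearNorm_lt_nuclearNorm_add A H hA e α hα hα0 ?_
  exact sum_abs_inner_lt_of_seminorm_eq_zero hC hs (ha.trans_le hr) hCc N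
    (fun T W hT hW => (hN T W hT hW).1) (fun T W hT hW => (hN T W hT (hW.trans (by omega))).2)
    e _ hdiag (hker H hH hX) (fun h => hne ((LinearEquiv.map_eq_zero_iff _).1 h))

theorem columnsMulVec_columns {p : ℕ}
    (T : EuclideanSpace ℝ (Fin p) →ₗ[ℝ] EuclideanSpace ℝ (Fin p)) (y : EuclideanSpace ℝ (Fin p)) :
    columnsMulVec (columns T) y = T y := by
  conv_rhs => rw [← (EuclideanSpace.basisFun (Fin p) ℝ).sum_repr y]
  simp [columnsMulVec, columns_apply]

theorem inner_toEuclideanLin_self {p : ℕ} (H : Matrix (Fin p) (Fin p) ℝ) (x : Fin p → ℝ) :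
    inner ℝ (Matrix.toEuclideanLin H (WithLp.toLp 2 x)) (WithLp.toLp 2 x) = x ⬝ᵥ H.mulVec x := by
  rw [Matrix.toLpLin_toLp, EuclideanSpace.inner_toLp_toLp]
  simp

/-- The rotated pair is `((x + y)/√2, (y - x)/√2)`; by symmetry of `H` the cross terms cancel. A
difference of quadratic measurements thus becomes a bilinear form in two independent vectors. -/
theorem columnsForm_rotation_eq {p : ℕ} {H : Matrix (Fin p) (Fin p) ℝ} (hH : H.IsSymm)
    (x y : Fin p → ℝ) :
    columnsForm (ContinuousLinearMap.rotation (Real.pi / 4) (WithLp.toLp 2 x, WithLp.toLp 2 y))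
      (columns (Matrix.toEuclideanLin H)) =
      (y ⬝ᵥ H.mulVec y - x ⬝ᵥ H.mulVec x) / 2 := by
  have hs := isSymmetric_toEuclideanLin_of_isSymm hH
  rw [columnsForm_apply, columnsMulVec_columns, ContinuousLinearMap.rotation_apply,
    Real.cos_pi_div_four, Real.sin_pi_div_four, ← inner_toEuclideanLin_self,
    ← inner_toEuclideanLin_self]
  have h1 : inner ℝ (Matrix.toEuclideanLin H (WithLp.toLp 2 x)) (WithLp.toLp 2 y) =
      inner ℝ (Matrix.toEuclideanLin H (WithLp.toLp 2 y)) (WithLp.toLp 2 x) := by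
    rw [hs, real_inner_comm]
  have h2 : √(2 : ℝ) * √2 = 2 := Real.mul_self_sqrt (by norm_num)
  simp only [map_add, map_smul, inner_add_left, inner_add_right, inner_smul_left,
    inner_smul_right, conj_trivial, h1]
  linear_combination (inner ℝ (Matrix.toEuclideanLin H (WithLp.toLp 2 y)) (WithLp.toLp 2 y) -
    inner ℝ (Matrix.toEuclideanLin H (WithLp.toLp 2 x)) (WithLp.toLp 2 x)) / 4 * h2

end Recovery

/-! ### The law of the rotated pairs -/

section Law

open MeasureTheory ProbabilityTheory

/-- The rotation by `π / 4` of a pair of vectors. -/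
noncomputable def rotatedPair {p : ℕ} (z : (Fin p → ℝ) × (Fin p → ℝ)) :
    EuclideanSpace ℝ (Fin p) × EuclideanSpace ℝ (Fin p) :=
  ContinuousLinearMap.rotation (Real.pi / 4) (WithLp.toLp 2 z.1, WithLp.toLp 2 z.2)

theorem measurable_rotatedPair {p : ℕ} : Measurable (rotatedPair (p := p)) := by
  unfold rotatedPair
  fun_prop

theorem map_rotatedPair {p : ℕ} :
    ((Measure.pi fun _ : Fin p => gaussianReal 0 1).prod
      (Measure.pi fun _ : Fin p => gaussianReal 0 1)).map rotatedPair =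
      (stdGaussian (EuclideanSpace ℝ (Fin p))).prod (stdGaussian (EuclideanSpace ℝ (Fin p))) := by
  have h1 : rotatedPair (p := p) =
    (ContinuousLinearMap.rotation (E := EuclideanSpace ℝ (Fin p)) (Real.pi / 4)) ∘
      Prod.map (WithLp.toLp 2) (WithLp.toLp 2) := rfl
  rw [h1, ← Measure.map_map (by fun_prop) (by fun_prop),
    ← Measure.map_prod_map _ _ (by fun_prop) (by fun_prop), map_pi_eq_stdGaussian]
  exact IsGaussian.map_rotation_eq_self (by simp [integral_id_stdGaussian]) _

theorem measurable_uncurryPairs {m p : ℕ} : Measurable fun (z : Fin m → (Fin p → ℝ) × (Fin p → ℝ))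
    (k : (Fin m × Bool) × Fin p) => cond k.1.2 ((z k.1.1).2 k.2) ((z k.1.1).1 k.2) := by
  refine measurable_pi_lambda _ fun k => ?_
  rcases k with ⟨⟨i, c⟩, j⟩
  cases c <;> simp only [cond_true, cond_false] <;> fun_prop

/-- Pairs of independent standard Gaussian vectors, written as a Gaussian vector indexed by all
the coordinates. -/
theorem map_pi_prod_uncurry_gaussianReal (m p : ℕ) :
    (Measure.pi fun _ : Fin m => (Measure.pi fun _ : Fin p => gaussianReal 0 1).prod
      (Measure.pi fun _ : Fin p => gaussianReal 0 1)).map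
      (fun z (k : (Fin m × Bool) × Fin p) => cond k.1.2 ((z k.1.1).2 k.2) ((z k.1.1).1 k.2)) =
      Measure.pi fun _ => gaussianReal 0 1 := by
  symm
  refine Measure.pi_eq fun S hS => ?_
  rw [Measure.map_apply measurable_uncurryPairs (MeasurableSet.univ_pi hS)]
  have : (fun (z : Fin m → (Fin p → ℝ) × (Fin p → ℝ)) (k : (Fin m × Bool) × Fin p) =>
      cond k.1.2 ((z k.1.1).2 k.2) ((z k.1.1).1 k.2)) ⁻¹' Set.univ.pi S =
      Set.univ.pi fun i => (Set.univ.pi fun j => S ((i, false), j)) ×ˢ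
        (Set.univ.pi fun j => S ((i, true), j)) := by
    ext z
    simp only [Set.mem_preimage, Set.mem_univ_pi, Prod.forall, Bool.forall_bool, cond_true,
      cond_false, Set.mem_prod]
  rw [this, Measure.pi_pi]
  simp only [Measure.prod_prod, Measure.pi_pi, Fintype.prod_prod_type, Fintype.prod_bool]
  exact Finset.prod_congr rfl fun i _ => mul_comm _ _

theorem measurable_rotatedPair_pi (m p : ℕ) :
    Measurable fun (x : (Fin m × Bool) × Fin p → ℝ) (i : Fin m) =>
      rotatedPair (fun j => x ((i, false), j), fun j => x ((i, true), j)) := by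
  refine measurable_pi_lambda _ fun i => ?_
  have h : Measurable fun x : (Fin m × Bool) × Fin p → ℝ =>
      ((fun j => x ((i, false), j), fun j => x ((i, true), j)) : (Fin p → ℝ) × (Fin p → ℝ)) := by
    fun_prop
  exact measurable_rotatedPair.comp h

theorem map_rotatedPair_pi (m p : ℕ) :
    (Measure.pi fun _ : (Fin m × Bool) × Fin p => gaussianReal 0 1).map
      (fun x (i : Fin m) => rotatedPair (fun j => x ((i, false), j), fun j => x ((i, true), j))) =
      Measure.pi fun _ => (stdGaussian (EuclideanSpace ℝ (Fin p))).prod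
        (stdGaussian (EuclideanSpace ℝ (Fin p))) := by
  rw [← map_pi_prod_uncurry_gaussianReal,
    Measure.map_map (measurable_rotatedPair_pi m p) measurable_uncurryPairs]
  have h3 := Measure.pi_map_pi (ι := Fin m) (μ := fun _ =>
    (Measure.pi fun _ : Fin p => gaussianReal 0 1).prod
      (Measure.pi fun _ : Fin p => gaussianReal 0 1)) (f := fun _ => rotatedPair)
    (hμ := fun _ => by rw [map_rotatedPair]; infer_instance)
    (fun _ => measurable_rotatedPair.aemeasurable)
  rw [map_rotatedPair] at h3
  exact h3

theorem hasLaw_pi_of_hasIIDEntries {Ω ι : Type*} [Fintype ι] [MeasurableSpace Ω] {P : Measure Ω}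
    {n p : ℕ} {β : Fin n → Fin p → Ω → ℝ} (h : HasIIDEntries P β (gaussianReal 0 1))
    (idx : ι → Fin n × Fin p) (hidx : Function.Injective idx) :
    HasLaw (fun ω k => β (idx k).1 (idx k).2 ω) (Measure.pi fun _ : ι => gaussianReal 0 1) P := by
  obtain ⟨hind, hlaw⟩ := h
  have hae : ∀ k, AEMeasurable (β (idx k).1 (idx k).2) P := fun k => (hlaw _ _).aemeasurable
  refine ⟨aemeasurable_pi_lambda _ hae, ?_⟩
  have h1 := hind.precomp hidx
  refine (h1.map_fun_eq_pi_map hae).trans ?_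
  congr 1
  ext1 k
  exact (hlaw _ _).map_eq

theorem hasLaw_rotatedPair {Ω : Type*} [MeasurableSpace Ω] {P : Measure Ω} {n m p : ℕ}
    {β : Fin n → Fin p → Ω → ℝ} (h : HasIIDEntries P β (gaussianReal 0 1))
    (idx : Fin m × Bool → Fin n) (hidx : Function.Injective idx) :
    HasLaw (fun ω (i : Fin m) => rotatedPair
      (fun j => β (idx (i, false)) j ω, fun j => β (idx (i, true)) j ω))
      (Measure.pi fun _ => (stdGaussian (EuclideanSpace ℝ (Fin p))).prod
        (stdGaussian (EuclideanSpace ℝ (Fin p)))) P := by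
  have h1 := hasLaw_pi_of_hasIIDEntries h
    (fun k : (Fin m × Bool) × Fin p => (idx k.1, k.2)) (hidx.prodMap Function.injective_id)
  have h2 : HasLaw (fun (x : (Fin m × Bool) × Fin p → ℝ) (i : Fin m) =>
      rotatedPair (fun j => x ((i, false), j), fun j => x ((i, true), j))) _ _ :=
    ⟨(measurable_rotatedPair_pi m p).aemeasurable, map_rotatedPair_pi m p⟩
  exact h2.comp h1

/-- `X` is only a.e. measurable, so the preimage of `G` is replaced by a measurable subset of the
same measure. -/
theorem exists_measurableSet_of_hasLaw {Ω Z : Type*} [MeasurableSpace Ω] [MeasurableSpace Z]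
    {P : Measure Ω} [IsProbabilityMeasure P] {X : Ω → Z} {μ : Measure Z} (hX : HasLaw X μ P)
    {G : Set Z} (hG : MeasurableSet G) {ε : ℝ} (hε : 0 ≤ ε) (hμ : μ Gᶜ ≤ ENNReal.ofReal ε) :
    ∃ E : Set Ω, MeasurableSet E ∧ 1 - ε ≤ P.real E ∧ ∀ ω ∈ E, X ω ∈ G := by
  obtain ⟨E, hEsub, hE, hEae⟩ :=
    (hX.aemeasurable.nullMeasurableSet_preimage hG).exists_measurable_subset_ae_eq
  refine ⟨E, hE, ?_, fun ω hω => hEsub hω⟩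
  have h1 : P Eᶜ = μ Gᶜ := by
    rw [← hX.map_eq, Measure.map_apply_of_aemeasurable hX.aemeasurable hG.compl]
    exact measure_congr hEae.compl
  have h2 : P.real Eᶜ ≤ ε := ENNReal.toReal_le_of_le_ofReal hε (h1.trans_le hμ)
  rw [probReal_compl_eq_one_sub hE] at h2
  linarith

end Law

/-! ### Choice of constants and conclusion -/

theorem proposition2p2 :
    ∃ C : ℝ, 0 < C ∧ ∃ δ : ℝ, 0 < δ ∧
      ∀ (n p r : ℕ), C * (r : ℝ) * (p : ℝ) ≤ (n : ℝ) →
        ∀ {Ω : Type*} [MeasurableSpace Ω] (P : MeasureTheory.Measure Ω)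
          [MeasureTheory.IsProbabilityMeasure P] (β : Fin n → Fin p → Ω → ℝ),
          HasIIDEntries P β (ProbabilityTheory.gaussianReal 0 1) →
          ∃ E : Set Ω, MeasurableSet E ∧ 1 - Real.exp (-((n : ℝ) * δ)) ≤ P.real E ∧
            ∀ ω ∈ E, RecoversSymmetric (sropMap (fun i j => β i j ω)) r := by
  -- With `K = (2 + 10⁷) r`, the condition `20pK + 1 ≤ m/16384` asks for `m` of order `3.3 · 10¹²
  -- rp`, and `n ≤ 3m`. The rate is `1/49152 = 1/(3 · 16384)`.
  refine ⟨10 ^ 14, by norm_num, 1 / 49152, by norm_num, ?_⟩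
  intro n p r hn Ω _ P _ β hβ
  rcases Nat.eq_zero_or_pos r with rfl | hr
  · exact ⟨Set.univ, MeasurableSet.univ, by simpa using (Real.exp_pos _).le,
      fun ω _ => recoversSymmetric_zero _⟩
  rcases Nat.eq_zero_or_pos p with rfl | hp
  · refine ⟨Set.univ, MeasurableSet.univ, by simpa using (Real.exp_pos _).le, fun ω _ => ?_⟩
    exact recoversSymmetric_of_forall_lt fun A H _ _ _ _ hH =>
      absurd (Subsingleton.elim H 0) hH
  have hrp : (1 : ℝ) ≤ r * p := by exact_mod_cast Nat.mul_pos hr hp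
  set m := n / 2 with hm
  have hmn : (n : ℝ) ≤ 3 * m := by
    have h2 : (2 : ℝ) ≤ n := by nlinarith
    have h2' : 2 ≤ n := by exact_mod_cast h2
    have : n ≤ 3 * m := by omega
    exact_mod_cast this
  have hm0 : (0 : ℝ) < m := by nlinarith
  obtain ⟨G, hG, hGc, hGbound⟩ := exists_event_sumAbsForm_bounds
    (m := m) (p := p) (K := 2 * r + 10 ^ 7 * r) (by push_cast; nlinarith)
  -- The pairs are `(2i, 2i + 1)`; for odd `n` the last measurement is discarded.
  let idx : Fin m × Bool → Fin n := fun k =>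
    ⟨2 * k.1 + cond k.2 1 0, by rcases k with ⟨i, _ | _⟩ <;> simp <;> omega⟩
  have hidx : Function.Injective idx := by
    rintro ⟨i, c⟩ ⟨j, d⟩ h
    simp only [idx, Fin.mk.injEq] at h
    cases c <;> cases d <;> simp at h ⊢ <;> omega
  obtain ⟨E, hE, hPE, hEG⟩ := exists_measurableSet_of_hasLaw (hasLaw_rotatedPair hβ idx hidx) hG
    (Real.exp_pos _).le hGc
  refine ⟨E, hE, le_trans ?_ hPE, fun ω hω => ?_⟩
  · have : Real.exp (-(m : ℝ) / 16384) ≤ Real.exp (-((n : ℝ) * (1 / 49152))) :=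
      Real.exp_le_exp.2 (by linarith)
    linarith
  · refine recoversSymmetric_of_seminorm_bounds (s := 10 ^ 7 * r) (c := m / 256) (C := 12 * m)
      (by positivity) (by positivity) ?_ _ _ (hGbound _ (hEG ω hω)) ?_
    · push_cast
      rw [Real.sqrt_mul (by positivity)]
      -- The requirement `12m √r < (m/256) √s` amounts to `√(10⁷) > 12 · 256 = 3072`.
      have h1 : (3100 : ℝ) ≤ √(10 ^ 7) := Real.le_sqrt_of_sq_le (by norm_num)
      have h2 : 0 < √(r : ℝ) := by positivity
      have h3 : (m : ℝ) / 256 * (3100 * √r) ≤ m / 256 * (√(10 ^ 7) * √r) := by gcongr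
      have h4 : 0 < (m : ℝ) * √r := by positivity
      nlinarith
    · intro H hH hX
      rw [sumAbsForm_apply]
      apply Finset.sum_eq_zero
      intro i _
      rw [rotatedPair, columnsForm_rotation_eq hH]
      have h1 : (fun j => β (idx (i, false)) j ω) ⬝ᵥ H.mulVec (fun j => β (idx (i, false)) j ω) = 0 :=
        congrFun hX (idx (i, false))
      have h2 : (fun j => β (idx (i, true)) j ω) ⬝ᵥ H.mulVec (fun j => β (idx (i, true)) j ω) = 0 :=
        congrFun hX (idx (i, true))
      rw [h1, h2]
      simp
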